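/- **Model.** A typical receiver sits at the origin of $\mathbb{R}^2$. Roads are (i) a typical line through the origin and (ii) the lines of a motion-invariant Poisson line process of intensity $\lambda_R>0$: the line with parameters $(\theta,y)$ is $\{y(\cos\theta,\sin\theta)+t(-\sin\theta,\cos\theta):t\in\mathbb{R}\}$, and the parameters form a Poisson point process on $[0,\pi]\times\mathbb{R}$ with intensity $\lambda_R\,d\theta\,dy$. Given the roads, each road independently carries vehicles forming a homogeneous Poisson process of intensity $\mu_v>0$. All vehicles transmit with power $P_v>0$; the path-loss exponent is $\alpha>1$, the noise power is $\sigma^2\ge 0$, and all channel gains are independent, independent of the locations, and exponential with mean $1$. Let $R_v$ be the distance from the origin to the nearest vehicle. For a link of length $r>0$ the interferers are the vehicles outside the disk of radius $r$ about the origin: let $$I_r=\sum_x P_v h_x\|x\|^{-\alpha},\qquad I_v=\sum_x P_v h_x\|x\|^{-\alpha},$$ summed over the vehicles $x$ with $\|x\|>r$ on the typical road, respectively on all other roads. For a threshold $z>0$, the success probability at link distance $r$ is $$P^S_{v2v}(z|r)=\Pr\Big[\frac{P_v r^{-\alpha}h}{I_v+I_r+\sigma^2}>z\Big],$$ with $h$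 the gain of the link. Without cellular base stations every vehicle uses the V2V link, and the success probability is obtained by removing the condition on the link distance: $P^{only}_{v2v}(z)=\mathbb{E}\big[P^S_{v2v}(z|R_v)\big]$. For $s>0$ write $\mathcal{L}_{I_v}(s|r)=\mathbb{E}[e^{-sI_v}]$ and $\mathcal{L}_{I_r}(s|r)=\mathbb{E}[e^{-sI_r}]$ for the Laplace transforms of the interferences at link distance $r$, with $e^{-\infty}=0$. **Statement.** For every $z>0$, $$P^{only}_{v2v}(z)=\int_0^\infty \exp\Big(-\frac{z\sigma^2}{P_v r_v^{-\alpha}}\Big)\,\mathcal{L}_{I_v}\Big(\frac{z}{P_v r_v^{-\alpha}}\Big|r_v\Big)\,\mathcal{L}_{I_r}\Big(\frac{z}{P_v r_v^{-\alpha}}\Big|r_v\Big)\,f_{R_v}(r_v)\,dr_v,$$ where: 1. $R_v$ has the probability density, for $r>0$, $$f_{R_v}(r)=\Big(4\pi\lambda_R\mu_v\int_0^r\frac{r\,e^{-2\mu_v\sqrt{r^2-y^2}}}{\sqrt{r^2-y^2}}\,dy+2\mu_v\Big)\exp\Big(-2\pi\lambda_R\int_0^r\big(1-e^{-2\mu_v\sqrt{r^2-y^2}}\big)dy-2r\mu_v\Big);$$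 2. for $r,s>0$, $$\mathcal{L}_{I_v}(s|r)=\exp\Big(-2\pi\lambda_R\int_0^r\big(1-\mathcal{L}_{in}(s,y)\big)dy\Big)\exp\Big(-2\pi\lambda_R\int_r^\infty\big(1-\mathcal{L}_{out}(s,y)\big)dy\Big),$$ $$\mathcal{L}_{in}(s,y)=\exp\Big[-2\mu_v\int_{\sqrt{r^2-y^2}}^\infty\Big(1-\frac{1}{1+sP_v(y^2+t^2)^{-\alpha/2}}\Big)dt\Big],\quad \mathcal{L}_{out}(s,y)=\exp\Big[-2\mu_v\int_0^\infty\Big(1-\frac{1}{1+sP_v(y^2+t^2)^{-\alpha/2}}\Big)dt\Big]$$ (a divergent integral in an exponent gives the factor $0$); 3. for $r>0$ and $s=z/(P_vr^{-\alpha})$, $$\mathcal{L}_{I_r}(s|r)=\exp\Big[-\frac{2\,r\,z\,\mu_v\;{}_2F_1\big(1,\tfrac{\alpha-1}{\alpha};2-\tfrac1\alpha;-z\big)}{\alpha-1}\Big].$$ -/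

import Mathlib

open MeasureTheory ProbabilityTheory Set
open scoped ENNReal

noncomputable section

namespace V2V

/-- Number of points of the family `X` (with multiplicity) that lie in `A`. -/
def count {Ω E : Type*} (X : ℕ → Ω → E) (A : Set E) (ω : Ω) : ℝ≥0∞ :=
  ∑' n, A.indicator (fun _ => (1 : ℝ≥0∞)) (X n ω)

/-- The random points `X 0, X 1, …` form (an enumeration of) a Poisson point process with
intensity measure `ν`: the number of points in a set `A` of finite `ν`-measure is Poisson
distributed with mean `ν A`, and the numbers of points in disjoint sets are independent. The
intensity measures used below are infinite, so that there are infinitely many points. -/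
structure IsPoissonProcess {Ω E : Type*} [MeasurableSpace Ω] [MeasurableSpace E]
    (X : ℕ → Ω → E) (ν : Measure E) (P : Measure Ω) : Prop where
  measurable : ∀ n, Measurable (X n)
  poisson : ∀ A : Set E, MeasurableSet A → ν A ≠ ∞ →
    P.map (count X A) = (poissonMeasure (ν A).toNNReal).map (fun k : ℕ => (k : ℝ≥0∞))
  indep : ∀ (m : ℕ) (A : Fin m → Set E), (∀ i, MeasurableSet (A i)) → (∀ i, ν (A i) ≠ ∞) →
    Pairwise (fun i j => Disjoint (A i) (A j)) → iIndepFun (fun i => count X (A i)) P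

/-- The random data of the network seen from the typical receiver at the origin. Roads are indexed
by `Option ℕ`: `none` is the typical road through the origin, `some n` is the `n`-th of the other
roads. -/
structure RoadNetwork (Ω : Type*) where
  /-- angle of the normal of the typical road -/
  angle : ℝ
  /-- parameters `(θ, y)` of the other roads: the `n`-th road is the line at signed distance `y`
  from the origin whose normal has angle `θ` -/
  road : ℕ → Ω → ℝ × ℝ
  /-- signed position of the `k`-th vehicle along the `i`-th road, measured from the foot of the
  perpendicular from the origin -/
  pos : Option ℕ → ℕ → Ω → ℝ
  /-- channel gain from the `k`-th vehicle of the `i`-th road to the typical receiver -/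
  gain : Option ℕ → ℕ → Ω → ℝ
  /-- channel gain of the link from the serving transmitter to the typical receiver -/
  linkGain : Ω → ℝ

/-- The sources of randomness. -/
inductive Source where
  | roads
  | vehicles (i : Option ℕ)
  | gain (i : Option ℕ) (k : ℕ)
  | link

namespace RoadNetwork

variable {Ω : Type*} (N : RoadNetwork Ω)

/-- The σ-algebra generated by a source of randomness. -/
@[reducible] def sigma : Source → MeasurableSpace Ω
  | .roads => MeasurableSpace.comap (fun ω n => N.road n ω) inferInstance
  | .vehicles i => MeasurableSpace.comap (fun ω k => N.pos i k ω) inferInstance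
  | .gain i k => MeasurableSpace.comap (N.gain i k) inferInstance
  | .link => MeasurableSpace.comap N.linkGain inferInstance

/-- Parameters of the `i`-th road. -/
def line (ω : Ω) : Option ℕ → ℝ × ℝ
  | none => (N.angle, 0)
  | some n => N.road n ω

/-- Location in the plane of the `k`-th vehicle of the `i`-th road: the point
`y (cos θ, sin θ) + t (- sin θ, cos θ)`. -/
def loc (i : Option ℕ) (k : ℕ) (ω : Ω) : EuclideanSpace ℝ (Fin 2) :=
  (N.line ω i).2 • !₂[Real.cos (N.line ω i).1, Real.sin (N.line ω i).1]
    + N.pos i k ω • !₂[-Real.sin (N.line ω i).1, Real.cos (N.line ω i).1]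

/-- Distance `R_v` from the typical receiver to the nearest vehicle. -/
def nearestDist (ω : Ω) : ℝ := ⨅ p : Option ℕ × ℕ, ‖N.loc p.1 p.2 ω‖

/-- Interference at the origin from the vehicles of the `i`-th road outside the disk of radius
`r`, for transmit power `Pv` and path-loss exponent `α`. -/
def roadInterference (Pv α r : ℝ) (i : Option ℕ) (ω : Ω) : ℝ≥0∞ :=
  ∑' k, if r < ‖N.loc i k ω‖
    then ENNReal.ofReal (Pv * N.gain i k ω * ‖N.loc i k ω‖ ^ (-α)) else 0

/-- `I_r`: interference from the road through the origin. -/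
def Ir (Pv α r : ℝ) (ω : Ω) : ℝ≥0∞ := N.roadInterference Pv α r none ω

/-- `I_v`: interference from all other roads. -/
def Iv (Pv α r : ℝ) (ω : Ω) : ℝ≥0∞ := ∑' n, N.roadInterference Pv α r (some n) ω

/-- Signal to interference and noise ratio of a link of length `r`, noise power `σ²`. -/
def sinr (Pv α σ r : ℝ) (ω : Ω) : ℝ≥0∞ :=
  ENNReal.ofReal (Pv * r ^ (-α) * N.linkGain ω)
    / (N.Iv Pv α r ω + N.Ir Pv α r ω + ENNReal.ofReal (σ ^ 2))

/-- Success probability at SINR threshold `z` for a given link distance `r`. -/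
def condSuccessProb [MeasurableSpace Ω] (P : Measure Ω) (Pv α σ z r : ℝ) : ℝ≥0∞ :=
  P {ω | ENNReal.ofReal z < N.sinr Pv α σ r ω}

/-- Success probability without cellular network: every vehicle uses the V2V link, and the
condition on the link distance is removed by averaging over the nearest-vehicle distance. -/
def successProb [MeasurableSpace Ω] (P : Measure Ω) (Pv α σ z : ℝ) : ℝ≥0∞ :=
  ∫⁻ ω, N.condSuccessProb P Pv α σ z (N.nearestDist ω) ∂P

end RoadNetwork

/-- The probabilistic assumptions: the roads form a motion-invariant Poisson line process of
intensity `lam` on `[0, π] × ℝ`; the vehicles of each road form a homogeneous Poisson process of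
intensity `mu`; all channel gains are exponential with unit mean; everything is independent. -/
structure IsPoissonRoadNetwork {Ω : Type*} [MeasurableSpace Ω] (N : RoadNetwork Ω)
    (P : Measure Ω) (lam mu : ℝ) : Prop where
  roads : IsPoissonProcess N.road
    (ENNReal.ofReal lam • (volume : Measure (ℝ × ℝ)).restrict (Icc 0 Real.pi ×ˢ univ)) P
  vehicles : ∀ i, IsPoissonProcess (N.pos i) (ENNReal.ofReal mu • (volume : Measure ℝ)) P
  gain_measurable : ∀ i k, Measurable (N.gain i k)
  gain_law : ∀ i k, P.map (N.gain i k) = expMeasure 1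
  link_measurable : Measurable N.linkGain
  link_law : P.map N.linkGain = expMeasure 1
  indep : iIndep N.sigma P

/-- `exp (-x)` for `x ∈ [0, ∞]`, with `exp (-∞) = 0`. -/
def expNeg (x : ℝ≥0∞) : ℝ≥0∞ := EReal.exp (-(x : EReal))

/-- Laplace transform `E[exp (-s X)]` of a random variable `X` with values in `[0, ∞]`. -/
def laplace {Ω : Type*} [MeasurableSpace Ω] (P : Measure Ω) (X : Ω → ℝ≥0∞) (s : ℝ) : ℝ≥0∞ :=
  ∫⁻ ω, expNeg (ENNReal.ofReal s * X ω) ∂P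

/-- The probability density of the nearest-vehicle distance. -/
def pdfRv (lam mu r : ℝ) : ℝ :=
  (4 * Real.pi * lam * mu
      * (∫ y in (0 : ℝ)..r,
          r * Real.exp (-2 * mu * Real.sqrt (r ^ 2 - y ^ 2)) / Real.sqrt (r ^ 2 - y ^ 2))
    + 2 * mu)
  * Real.exp (-2 * Real.pi * lam
        * (∫ y in (0 : ℝ)..r, (1 - Real.exp (-2 * mu * Real.sqrt (r ^ 2 - y ^ 2))))
      - 2 * r * mu)

/-- Laplace transform at `s` of the interference from a single road at distance `y` from the
origin, from the vehicles at distance more than `a` from the foot of the perpendicular. -/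
def lapRoad (mu Pv α s y a : ℝ) : ℝ≥0∞ :=
  expNeg (ENNReal.ofReal (2 * mu) * ∫⁻ t in Ioi a,
    ENNReal.ofReal (1 - 1 / (1 + s * Pv * (y ^ 2 + t ^ 2) ^ (-α / 2))))

/-- A road at distance `y < r`: its interferers lie outside the disk of radius `r`. -/
def lapIn (mu Pv α s r y : ℝ) : ℝ≥0∞ := lapRoad mu Pv α s y (Real.sqrt (r ^ 2 - y ^ 2))

/-- A road at distance `y > r`: its interferers may be anywhere. -/
def lapOut (mu Pv α s y : ℝ) : ℝ≥0∞ := lapRoad mu Pv α s y 0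

/-- Closed form of the Laplace transform of `I_v` at `s` for link distance `r`. -/
def lapIv (lam mu Pv α s r : ℝ) : ℝ≥0∞ :=
  expNeg (ENNReal.ofReal (2 * Real.pi * lam) * ∫⁻ y in Ioc 0 r, (1 - lapIn mu Pv α s r y))
    * expNeg (ENNReal.ofReal (2 * Real.pi * lam) * ∫⁻ y in Ioi r, (1 - lapOut mu Pv α s y))

/-- The Gauss hypergeometric function `₂F₁(a, b; c; x)` for `0 < b < c` and real `x < 1`, by Euler's
integral. (The power series converges only for `|x| < 1`, whereas the value at `-z` is needed for
every `z > 0`.) -/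
def hyp2F1 (a b c x : ℝ) : ℝ :=
  Real.Gamma c / (Real.Gamma b * Real.Gamma (c - b))
    * ∫ t in (0 : ℝ)..1, t ^ (b - 1) * (1 - t) ^ (c - b - 1) * (1 - x * t) ^ (-a)

/-- Closed form of the Laplace transform of `I_r` at `s = z / (P_v r ^ (-α))`. -/
def lapIr (mu α z r : ℝ) : ℝ≥0∞ :=
  ENNReal.ofReal (Real.exp
    (-(2 * r * z * mu * hyp2F1 1 ((α - 1) / α) (2 - 1 / α) (-z) / (α - 1))))

end V2V

end

/-!
The argument computes one Laplace functional and evaluates it on two families of test functions.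

For a Poisson process `X` with `σ`-finite intensity `ν` and measurable `f ≥ 0`,
`E[exp (-∑ f (X n))] = exp (-∫ (1 - exp (-f)) dν)` (`IsPoissonProcess.lintegral_expNeg_tsum`): for
simple `f` the sum is a combination of independent Poisson counts, and the general case is a
monotone limit. Independent marks are removed by `lintegral_expNeg_tsum_marks`: averaging over
marks `Z k` turns a summand `f k (Y, Z k)` into `-log E[exp (-f k (y, Z k))]` at `y = Y`, which is
again a summand of the kind the first formula handles. This is used twice. On a road in fixed
position the gains are marks of the vehicles, which gives the functional `roadLaplace` of one road.
The vehicles and gains of a road, taken together, are a mark of that road, which gives the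
functional of the whole road process (`lintegral_expNeg_other_roads`). The typical road is
independent of the other roads, so their functionals multiply.

* With summand `s P_v h d ^ (-α)` for `d > r`, and the Laplace transform `1 / (1 + c)` of the
  exponential gain, the functionals are the Laplace transforms of `I_v` and `I_r`. For the typical
  road the substitution `t = r v ^ (-1 / α)` produces Euler's integral for `₂F₁`.
* With summand `∞` for `d < r`, the functional is the probability that the disk of radius `r` holds
  no vehicle, i.e. that `R_v ≥ r`. After rescaling the chord integral to `[0, 1]` it is
  differentiable in `r`, and an integration by parts identifies its derivative with `-f_{R_v}`.
* The gain of the link has an exponential tail, so conditionally on the interference the success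
  probability is `exp (-s (I_v + I_r + σ²))` with `s = z / (P_v r ^ (-α))`; its mean factorizes, and
  integration against the law of `R_v` gives the last formula.
-/

noncomputable section

namespace V2V

/-! ### The function `expNeg` -/

lemma expNeg_eq_inv (x : ℝ≥0∞) : expNeg x = (EReal.exp (x : EReal))⁻¹ := by
  rw [expNeg, EReal.exp_neg]

@[simp] lemma expNeg_zero : expNeg 0 = 1 := by simp [expNeg]

@[simp] lemma expNeg_top : expNeg ∞ = 0 := by simp [expNeg]

lemma expNeg_ofReal {x : ℝ} (hx : 0 ≤ x) :
    expNeg (ENNReal.ofReal x) = ENNReal.ofReal (Real.exp (-x)) := by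
  rw [expNeg, EReal.coe_ennreal_ofReal, max_eq_left hx, ← EReal.coe_neg, EReal.exp_coe]

lemma expNeg_add (x y : ℝ≥0∞) : expNeg (x + y) = expNeg x * expNeg y := by
  rcases eq_or_ne x ∞ with rfl | hx
  · simp
  rcases eq_or_ne y ∞ with rfl | hy
  · simp
  rw [← ENNReal.ofReal_toReal hx, ← ENNReal.ofReal_toReal hy,
    ← ENNReal.ofReal_add (by positivity) (by positivity), expNeg_ofReal (by positivity),
    expNeg_ofReal (by positivity), expNeg_ofReal (by positivity),
    ← ENNReal.ofReal_mul (by positivity), ← Real.exp_add, neg_add]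

lemma expNeg_sum {ι : Type*} (s : Finset ι) (f : ι → ℝ≥0∞) :
    expNeg (∑ i ∈ s, f i) = ∏ i ∈ s, expNeg (f i) := by
  classical
  induction s using Finset.induction_on with
  | empty => simp
  | insert a s ha ih => rw [Finset.sum_insert ha, Finset.prod_insert ha, expNeg_add, ih]

lemma continuous_expNeg : Continuous expNeg :=
  ENNReal.continuous_exp.comp (continuous_neg.comp continuous_coe_ennreal_ereal)

lemma measurable_expNeg : Measurable expNeg := continuous_expNeg.measurable

lemma measurable_expNeg_const_mul (a : ℝ≥0∞) : Measurable fun x => expNeg (a * x) :=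
  measurable_expNeg.comp (measurable_const_mul a)

lemma expNeg_antitone : Antitone expNeg := fun x y h => by
  rw [expNeg_eq_inv, expNeg_eq_inv]
  exact ENNReal.inv_le_inv.2 (EReal.exp_monotone (EReal.coe_ennreal_le_coe_ennreal_iff.2 h))

lemma expNeg_le_one (x : ℝ≥0∞) : expNeg x ≤ 1 := by
  simpa using expNeg_antitone (zero_le (a := x))

lemma expNeg_ne_top (x : ℝ≥0∞) : expNeg x ≠ ∞ :=
  ne_top_of_le_ne_top ENNReal.one_ne_top (expNeg_le_one x)

lemma expNeg_iSup {ι : Type*} [Nonempty ι] (f : ι → ℝ≥0∞) :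
    expNeg (⨆ i, f i) = ⨅ i, expNeg (f i) :=
  expNeg_antitone.map_ciSup_of_continuousAt continuous_expNeg.continuousAt (OrderTop.bddAbove _)

lemma expNeg_tsum (f : ℕ → ℝ≥0∞) :
    expNeg (∑' k, f k) = ⨅ n, ∏ k ∈ Finset.range n, expNeg (f k) := by
  rw [ENNReal.tsum_eq_iSup_nat, expNeg_iSup]
  simp_rw [expNeg_sum]

/-- The inverse of `expNeg` on `[0, 1]`: minus the logarithm, with `negLog 0 = ∞`. -/
def negLog (x : ℝ≥0∞) : ℝ≥0∞ := (-(ENNReal.log x)).toENNReal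

lemma expNeg_negLog {x : ℝ≥0∞} (hx : x ≤ 1) : expNeg (negLog x) = x := by
  have h : 0 ≤ -(ENNReal.log x) := by
    rw [← neg_zero, EReal.neg_le_neg_iff]; simpa using hx
  rw [expNeg, negLog, EReal.coe_toENNReal h, neg_neg, ENNReal.exp_log]

lemma measurable_negLog : Measurable negLog :=
  measurable_ereal_toENNReal.comp (continuous_neg.measurable.comp ENNReal.measurable_log)

/-- Laplace transform of a Poisson random variable with values in `[0, ∞]`. -/
lemma lintegral_expNeg_poisson {ν : ℝ≥0∞} (hν : ν ≠ ∞) (a : ℝ≥0∞) :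
    ∫⁻ x, expNeg (a * x) ∂((poissonMeasure ν.toNNReal).map (fun k : ℕ => (k : ℝ≥0∞)))
      = expNeg ((1 - expNeg a) * ν) := by
  rw [lintegral_map (measurable_expNeg_const_mul a) .of_discrete,
    poissonMeasure, lintegral_sum_measure]
  simp_rw [lintegral_smul_measure, lintegral_dirac, smul_eq_mul]
  obtain ⟨b, hb0, hb1, hb⟩ : ∃ b : ℝ, 0 ≤ b ∧ b ≤ 1 ∧ expNeg a = ENNReal.ofReal b := by
    refine ⟨(expNeg a).toReal, by positivity, ?_, (ENNReal.ofReal_toReal (expNeg_ne_top a)).symm⟩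
    exact ENNReal.toReal_le_of_le_ofReal zero_le_one (by simpa using expNeg_le_one a)
  set r : ℝ := ν.toReal with hr
  have hr0 : 0 ≤ r := ENNReal.toReal_nonneg
  have hν' : ν = ENNReal.ofReal r := (ENNReal.ofReal_toReal hν).symm
  have hpow (k : ℕ) : expNeg (a * k) = ENNReal.ofReal (b ^ k) := by
    have : a * k = ∑ _i ∈ Finset.range k, a := by simp [mul_comm]
    rw [this, expNeg_sum, Finset.prod_const, Finset.card_range, hb, ENNReal.ofReal_pow hb0]
  have hterm (k : ℕ) : ENNReal.ofReal (Real.exp (-(ν.toNNReal : ℝ)) * (ν.toNNReal : ℝ) ^ k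
      / (k.factorial : ℝ)) * expNeg (a * k)
      = ENNReal.ofReal (Real.exp (-r) * ((r * b) ^ k / k.factorial)) := by
    rw [hpow, ← ENNReal.ofReal_mul (by positivity)]
    congr 1
    change Real.exp (-r) * r ^ k / _ * _ = _
    rw [mul_pow]; ring
  simp_rw [hterm]
  have hs : HasSum (fun k : ℕ => (r * b) ^ k / (k.factorial : ℝ)) (Real.exp (r * b)) := by
    have := NormedSpace.expSeries_div_hasSum_exp (r * b)
    rwa [← Real.exp_eq_exp_ℝ] at this
  have hs' := hs.mul_left (Real.exp (-r))
  rw [← ENNReal.ofReal_tsum_of_nonneg (fun k => by positivity) hs'.summable, hs'.tsum_eq, hb, hν',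
    ← ENNReal.ofReal_one, ← ENNReal.ofReal_sub _ hb0, ← ENNReal.ofReal_mul (by linarith),
    expNeg_ofReal (by nlinarith), ← Real.exp_add]
  congr 2; ring

/-! ### Laplace functional of a Poisson process -/

lemma tsum_simpleFunc_eq_sum_count {Ω E : Type*} [MeasurableSpace E] {X : ℕ → Ω → E}
    (g : SimpleFunc E ℝ≥0∞) (ω : Ω) :
    ∑' n, g (X n ω) = ∑ a ∈ g.range with a ≠ 0, a * count X (g ⁻¹' {a}) ω := by
  classical
  simp_rw [count, ← ENNReal.tsum_mul_left]
  rw [← Summable.tsum_finsetSum (fun _ _ => ENNReal.summable)]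
  refine tsum_congr fun n => ?_
  rw [Finset.sum_filter_of_ne (fun a _ h => by rintro rfl; simp at h),
    Finset.sum_eq_single (g (X n ω))]
  · simp
  · intro b _ hb
    simp [hb.symm]
  · simp

section Poisson

variable {Ω E : Type*} [MeasurableSpace Ω] [MeasurableSpace E] {X : ℕ → Ω → E} {ν : Measure E}
  {P : Measure Ω}

lemma measurable_count (hX : ∀ n, Measurable (X n)) {A : Set E} (hA : MeasurableSet A) :
    Measurable (count X A) :=
  Measurable.tsum fun n => (measurable_const.indicator hA).comp (hX n)

/-- The counts of the level sets of `g` are independent Poisson variables. -/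
lemma IsPoissonProcess.lintegral_expNeg_tsum_simpleFunc (hX : IsPoissonProcess X ν P)
    (g : SimpleFunc E ℝ≥0∞) (hg : ν (Function.support g) ≠ ∞) :
    ∫⁻ ω, expNeg (∑' n, g (X n ω)) ∂P = expNeg (∫⁻ x, (1 - expNeg (g x)) ∂ν) := by
  classical
  set s := g.range.filter (· ≠ 0) with hs
  have hfin (a : ℝ≥0∞) (ha : a ≠ 0) : ν (g ⁻¹' {a}) ≠ ∞ := by
    refine ne_top_of_le_ne_top hg (measure_mono fun x hx => ?_)
    rw [mem_preimage, mem_singleton_iff] at hx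
    simpa [hx] using ha
  let e := s.equivFin.symm
  have hind := hX.indep s.card (fun i => g ⁻¹' {(e i : ℝ≥0∞)})
    (fun i => g.measurableSet_fiber _)
    (fun i => hfin _ (Finset.mem_filter.1 (e i).2).2) (fun i j hij => by
      refine Disjoint.preimage _ (disjoint_singleton.2 fun h => hij ?_)
      exact e.injective (Subtype.ext h))
  have hind' := hind.comp (fun i x => expNeg ((e i : ℝ≥0∞) * x))
    (fun i => measurable_expNeg_const_mul _)
  have hprod (F : ℝ≥0∞ → ℝ≥0∞) : ∏ a ∈ s, F a = ∏ i, F (e i) := by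
    rw [← Finset.prod_coe_sort]
    exact (Equiv.prod_comp e (fun a : s => F a)).symm
  simp_rw [tsum_simpleFunc_eq_sum_count, expNeg_sum]
  rw [← hs]
  simp_rw [fun ω => hprod (fun a => expNeg (a * count X (g ⁻¹' {a}) ω))]
  have := lintegral_prod_eq_prod_lintegral_of_indepFun Finset.univ _ hind'
    (fun i => (measurable_expNeg_const_mul _).comp
      (measurable_count hX.measurable (g.measurableSet_fiber _)))
  simp only [Function.comp_apply] at this
  rw [this]
  have hone (i) : ∫⁻ ω, expNeg ((e i : ℝ≥0∞) * count X (g ⁻¹' {(e i : ℝ≥0∞)}) ω) ∂P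
      = expNeg ((1 - expNeg (e i : ℝ≥0∞)) * ν (g ⁻¹' {(e i : ℝ≥0∞)})) := by
    have hi := hfin _ (Finset.mem_filter.1 (e i).2).2
    rw [← lintegral_expNeg_poisson hi, ← hX.poisson _ (g.measurableSet_fiber _) hi,
      lintegral_map (measurable_expNeg_const_mul _)
        (measurable_count hX.measurable (g.measurableSet_fiber _))]
  simp_rw [hone]
  rw [← hprod (fun a => expNeg ((1 - expNeg a) * ν (g ⁻¹' {a}))), ← expNeg_sum]
  congr 1
  have h1 : ∀ x, 1 - expNeg (g x) = (g.map (fun a => 1 - expNeg a)) x := fun x => by simp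
  simp_rw [h1]
  rw [SimpleFunc.lintegral_eq_lintegral, SimpleFunc.map_lintegral, hs,
    Finset.sum_filter_of_ne (fun a _ h => by rintro rfl; simp at h)]

lemma iSup_tsum_of_monotone {f : ℕ → ℕ → ℝ≥0∞} (hf : Monotone f) :
    ∑' k, ⨆ n, f n k = ⨆ n, ∑' k, f n k := by
  simp_rw [← lintegral_count]
  exact lintegral_iSup (fun n => .of_discrete) hf

/-- **Laplace functional of a Poisson process.** The simple functions of finite support treated
above approximate `f` from below, and both sides pass to the monotone limit. -/
theorem IsPoissonProcess.lintegral_expNeg_tsum [SigmaFinite ν] [IsFiniteMeasure P]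
    (hX : IsPoissonProcess X ν P) {f : E → ℝ≥0∞} (hf : Measurable f) :
    ∫⁻ ω, expNeg (∑' n, f (X n ω)) ∂P = expNeg (∫⁻ x, (1 - expNeg (f x)) ∂ν) := by
  -- Restriction to the spanning sets makes the support of the approximants finite.
  let g (n : ℕ) : SimpleFunc E ℝ≥0∞ := (SimpleFunc.eapprox f n).restrict (spanningSets ν n)
  have hg (n : ℕ) (x : E) :
      g n x = (spanningSets ν n).indicator (SimpleFunc.eapprox f n) x := by
    rw [SimpleFunc.restrict_apply _ (measurableSet_spanningSets ν n)]
  have hmono : Monotone fun n x => g n x := by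
    intro n m hnm x
    simp only [hg]
    refine (indicator_le_indicator_of_subset (monotone_spanningSets ν hnm)
      (fun _ => zero_le) x).trans ?_
    exact indicator_le_indicator (SimpleFunc.monotone_eapprox f hnm x)
  have hsup (x : E) : ⨆ n, g n x = f x := by
    refine le_antisymm (iSup_le fun n => ?_) ?_
    · rw [hg, ← SimpleFunc.iSup_eapprox_apply hf x]
      exact (indicator_le_self' (fun _ _ => zero_le) x).trans
        (le_iSup (fun n => SimpleFunc.eapprox f n x) n)
    · rw [← SimpleFunc.iSup_eapprox_apply hf x]
      obtain ⟨N, hN⟩ : ∃ N, x ∈ spanningSets ν N := by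
        have := mem_univ x
        rwa [← iUnion_spanningSets ν, mem_iUnion] at this
      refine iSup_le fun n => le_iSup_of_le (max n N) ?_
      rw [hg, indicator_of_mem (monotone_spanningSets ν (le_max_right n N) hN)]
      exact SimpleFunc.monotone_eapprox f (le_max_left n N) x
  have hfin (n : ℕ) : ν (Function.support (g n)) ≠ ∞ := by
    refine ne_top_of_le_ne_top (measure_spanningSets_lt_top ν n).ne (measure_mono fun x hx => ?_)
    by_contra h
    exact hx (by rw [hg, indicator_of_notMem h])
  have hL : ∫⁻ ω, expNeg (∑' n, f (X n ω)) ∂P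
      = ⨅ n, ∫⁻ ω, expNeg (∑' k, g n (X k ω)) ∂P := by
    rw [← lintegral_iInf]
    · refine lintegral_congr fun ω => ?_
      simp_rw [← hsup]
      rw [iSup_tsum_of_monotone (fun n m h k => hmono h (X k ω)), expNeg_iSup]
    · exact fun n => measurable_expNeg.comp
        (Measurable.tsum fun k => (g n).measurable.comp (hX.measurable k))
    · exact fun n m h ω => expNeg_antitone (ENNReal.tsum_le_tsum fun k => hmono h (X k ω))
    · refine ne_top_of_le_ne_top (measure_ne_top P univ) ?_
      exact (lintegral_mono fun ω => expNeg_le_one _).trans (by simp)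
  have hR : ∫⁻ x, (1 - expNeg (f x)) ∂ν = ⨆ n, ∫⁻ x, (1 - expNeg (g n x)) ∂ν := by
    rw [← lintegral_iSup]
    · refine lintegral_congr fun x => ?_
      rw [← hsup, expNeg_iSup, ENNReal.sub_iInf]
    · exact fun n => measurable_const.sub (measurable_expNeg.comp (g n).measurable)
    · exact fun n m h x => tsub_le_tsub_left (expNeg_antitone (hmono h x)) 1
  rw [hL, hR, expNeg_iSup]
  exact iInf_congr fun n => hX.lintegral_expNeg_tsum_simpleFunc (g n) (hfin n)

end Poisson

/-! ### Independent marks -/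

section Marks

variable {Ω E F : Type*} [mΩ : MeasurableSpace Ω] [MeasurableSpace E] [MeasurableSpace F]
  {P : Measure Ω}

/-- Integrating out one variable that is independent of another one. -/
lemma lintegral_indepFun_eq [IsFiniteMeasure P] {V : Ω → E} {Z : Ω → F} (hV : Measurable V)
    (hZ : Measurable Z) (h : IndepFun V Z P) {f : E → F → ℝ≥0∞}
    (hf : Measurable (Function.uncurry f)) :
    ∫⁻ ω, f (V ω) (Z ω) ∂P = ∫⁻ ω, ∫⁻ ω', f (V ω) (Z ω') ∂P ∂P := by
  have h1 := (indepFun_iff_map_prod_eq_prod_map_map hV.aemeasurable hZ.aemeasurable).1 h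
  calc ∫⁻ ω, f (V ω) (Z ω) ∂P
      = ∫⁻ p, Function.uncurry f p ∂(P.map fun ω => (V ω, Z ω)) := by
        rw [lintegral_map hf (hV.prodMk hZ)]; rfl
    _ = ∫⁻ v, ∫⁻ z, f v z ∂(P.map Z) ∂(P.map V) := by
        rw [h1, lintegral_prod _ hf.aemeasurable]; rfl
    _ = ∫⁻ ω, ∫⁻ z, f (V ω) z ∂(P.map Z) ∂P :=
        lintegral_map (Measurable.lintegral_prod_right' hf) hV
    _ = _ := lintegral_congr fun ω => lintegral_map (hf.comp measurable_prodMk_left) hZ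

/-- **Independent marking.** If the marks `Z 0, Z 1, …` are independent of each other and of `Y`,
then averaging over the marks replaces each summand `f k (Y, Z k)` by
`-log E[exp (-f k (y, Z k))]` at `y = Y`. Independence is expressed by the σ-algebras `G k`, of
which `G k` carries `Y` and the marks before the `k`-th. -/
theorem lintegral_expNeg_tsum_marks [IsProbabilityMeasure P] {Y : Ω → E} {Z : ℕ → Ω → F}
    {G : ℕ → MeasurableSpace Ω} (hG : ∀ k, G k ≤ mΩ) (hY : ∀ k, Measurable[G k] Y)
    (hZG : ∀ j k, j < k → Measurable[G k] (Z j)) (hZ : ∀ k, Measurable (Z k))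
    (hind : ∀ k, Indep (G k) (MeasurableSpace.comap (Z k) inferInstance) P)
    {f : ℕ → E → F → ℝ≥0∞} (hf : ∀ k, Measurable (Function.uncurry (f k))) :
    ∫⁻ ω, expNeg (∑' k, f k (Y ω) (Z k ω)) ∂P
      = ∫⁻ ω, expNeg (∑' k, negLog (∫⁻ ω', expNeg (f k (Y ω) (Z k ω')) ∂P)) ∂P := by
  let φ (k : ℕ) (y : E) : ℝ≥0∞ := ∫⁻ ω', expNeg (f k y (Z k ω')) ∂P
  have hYm : Measurable Y := (hY 0).mono (hG 0) le_rfl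
  have hφ (k : ℕ) : Measurable (φ k) := by
    have : Measurable fun p : E × Ω => expNeg (f k p.1 (Z k p.2)) :=
      measurable_expNeg.comp ((hf k).comp (measurable_fst.prodMk ((hZ k).comp measurable_snd)))
    exact this.lintegral_prod_right'
  have hφ1 (k : ℕ) (y : E) : φ k y ≤ 1 :=
    (lintegral_mono fun ω => expNeg_le_one _).trans (by simp)
  -- The weight `g` lets the induction absorb the factors that are already averaged.
  have key (n : ℕ) : ∀ g : E → ℝ≥0∞, Measurable g →
      ∫⁻ ω, g (Y ω) * ∏ k ∈ Finset.range n, expNeg (f k (Y ω) (Z k ω)) ∂P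
        = ∫⁻ ω, g (Y ω) * ∏ k ∈ Finset.range n, φ k (Y ω) ∂P := by
    induction n with
    | zero => intro g _; simp
    | succ n ih =>
      intro g hg
      let V : Ω → E × (ℝ≥0∞) := fun ω =>
        (Y ω, g (Y ω) * ∏ k ∈ Finset.range n, expNeg (f k (Y ω) (Z k ω)))
      have hVG : Measurable[G n] V := by
        refine (hY n).prodMk ((hg.comp (hY n)).mul
          (Finset.measurable_prod _ fun k hk => measurable_expNeg.comp ((hf k).comp
            ((hY n).prodMk (hZG k n (Finset.mem_range.1 hk))))))
      have hVZ : IndepFun V (Z n) P :=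
        indep_of_indep_of_le_left (hind n) hVG.comap_le
      have h1 := lintegral_indepFun_eq (hVG.mono (hG n) le_rfl) (hZ n) hVZ
        (f := fun v z => v.2 * expNeg (f n v.1 z))
        (by
          have : Measurable fun p : (E × ℝ≥0∞) × F => (p.1.1, p.2) := by fun_prop
          exact (measurable_snd.comp measurable_fst).mul
            (measurable_expNeg.comp ((hf n).comp this)))
      have h2 := ih (fun y => g y * φ n y) (hg.mul (hφ n))
      simp_rw [Finset.prod_range_succ]
      calc _ = ∫⁻ ω, (g (Y ω) * ∏ k ∈ Finset.range n, expNeg (f k (Y ω) (Z k ω)))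
                * expNeg (f n (Y ω) (Z n ω)) ∂P := by simp_rw [mul_assoc]
        _ = ∫⁻ ω, (g (Y ω) * ∏ k ∈ Finset.range n, expNeg (f k (Y ω) (Z k ω)))
                * φ n (Y ω) ∂P := by
            rw [h1]
            refine lintegral_congr fun ω => ?_
            rw [lintegral_const_mul]
            exact measurable_expNeg.comp ((hf n).comp (measurable_const.prodMk (hZ n)))
        _ = ∫⁻ ω, g (Y ω) * φ n (Y ω) * ∏ k ∈ Finset.range n, expNeg (f k (Y ω) (Z k ω)) ∂P :=
            lintegral_congr fun ω => by ring
        _ = _ := by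
            rw [h2]
            exact lintegral_congr fun ω => by ring
  have hanti (u : ℕ → ℝ≥0∞) (hu : ∀ k, u k ≤ 1) :
      Antitone fun n => ∏ k ∈ Finset.range n, u k :=
    antitone_nat_of_succ_le fun n => by
      rw [Finset.prod_range_succ]; exact mul_le_of_le_one_right' (hu n)
  simp_rw [expNeg_tsum]
  have hneg (k : ℕ) (ω : Ω) :
      expNeg (negLog (∫⁻ ω', expNeg (f k (Y ω) (Z k ω')) ∂P)) = φ k (Y ω) :=
    expNeg_negLog (hφ1 k _)
  simp_rw [hneg]
  rw [lintegral_iInf, lintegral_iInf]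
  · refine iInf_congr fun n => ?_
    simpa using key n (fun _ => 1) measurable_const
  · exact fun n => Finset.measurable_prod _ fun k _ => (hφ k).comp hYm
  · exact fun n m h ω => hanti _ (fun k => hφ1 k _) h
  · simp
  · exact fun n => Finset.measurable_prod _ fun k _ => measurable_expNeg.comp
      ((hf k).comp (hYm.prodMk (hZ k)))
  · exact fun n m h ω => hanti _ (fun k => expNeg_le_one _) h
  · simp

end Marks

/-! ### Laplace functional of the road network -/

instance (x : ℝ) {α : Type*} [MeasurableSpace α] (ν : Measure α) [SigmaFinite ν] :
    SigmaFinite (ENNReal.ofReal x • ν) :=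
  inferInstanceAs (SigmaFinite (x.toNNReal • ν))

/-- `Measurable.tsum` for a σ-algebra that need not be the ambient instance. -/
lemma measurable_tsum_ennreal {α : Type*} {m : MeasurableSpace α} {f : ℕ → α → ℝ≥0∞}
    (hf : ∀ n, Measurable (f n)) : Measurable fun x => ∑' n, f n x :=
  Measurable.tsum hf

instance : IsProbabilityMeasure (expMeasure 1) := isProbabilityMeasure_expMeasure one_pos

namespace RoadNetwork

variable {Ω : Type*} (N : RoadNetwork Ω)

/-- The σ-algebra generated by a set of sources of randomness. -/
@[reducible] def sigmaOf (S : Set Source) : MeasurableSpace Ω := ⨆ s ∈ S, N.sigma s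

/-- Sum over the vehicles of the `i`-th road of a function of the road parameters, the position of
the vehicle on the road, and its gain. -/
def roadSum (f : ℝ × ℝ → ℝ → ℝ → ℝ≥0∞) (i : Option ℕ) (ω : Ω) : ℝ≥0∞ :=
  ∑' k, f (N.line ω i) (N.pos i k ω) (N.gain i k ω)

variable {N} {S : Set Source}

lemma sigma_le_sigmaOf {s : Source} (hs : s ∈ S) : N.sigma s ≤ N.sigmaOf S :=
  le_iSup₂_of_le s hs le_rfl

lemma measurable_road_sigmaOf (h : Source.roads ∈ S) (n : ℕ) : Measurable[N.sigmaOf S] (N.road n) :=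
  (measurable_pi_apply n).comp ((comap_measurable _).mono (sigma_le_sigmaOf (N := N) h) le_rfl)

lemma measurable_roadSeq_sigmaOf (h : Source.roads ∈ S) :
    Measurable[N.sigmaOf S] fun ω n => N.road n ω :=
  (comap_measurable _).mono (sigma_le_sigmaOf (N := N) h) le_rfl

lemma measurable_posSeq_sigmaOf {i : Option ℕ} (h : Source.vehicles i ∈ S) :
    Measurable[N.sigmaOf S] fun ω k => N.pos i k ω :=
  (comap_measurable _).mono (sigma_le_sigmaOf (N := N) h) le_rfl

lemma measurable_pos_sigmaOf {i : Option ℕ} (h : Source.vehicles i ∈ S) (k : ℕ) :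
    Measurable[N.sigmaOf S] (N.pos i k) :=
  (measurable_pi_apply k).comp ((comap_measurable _).mono (sigma_le_sigmaOf (N := N) h) le_rfl)

lemma measurable_gain_sigmaOf {i : Option ℕ} {k : ℕ} (h : Source.gain i k ∈ S) :
    Measurable[N.sigmaOf S] (N.gain i k) :=
  (comap_measurable _).mono (sigma_le_sigmaOf (N := N) h) le_rfl

lemma measurable_gainSeq_sigmaOf {i : Option ℕ} (h : ∀ k, Source.gain i k ∈ S) :
    Measurable[N.sigmaOf S] fun ω k => N.gain i k ω :=
  @measurable_pi_lambda _ _ _ (N.sigmaOf S) _ _ fun k => measurable_gain_sigmaOf (h k)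

lemma measurable_line_sigmaOf {i : Option ℕ} (h : i ≠ none → Source.roads ∈ S) :
    Measurable[N.sigmaOf S] fun ω => N.line ω i := by
  cases i with
  | none => exact measurable_const
  | some n => exact measurable_road_sigmaOf (h (by simp)) n

lemma measurable_roadSum_sigmaOf {f : ℝ × ℝ → ℝ → ℝ → ℝ≥0∞}
    (hf : Measurable fun p : (ℝ × ℝ) × ℝ × ℝ => f p.1 p.2.1 p.2.2) {i : Option ℕ}
    (hl : i ≠ none → Source.roads ∈ S) (hv : Source.vehicles i ∈ S)
    (hg : ∀ k, Source.gain i k ∈ S) : Measurable[N.sigmaOf S] (N.roadSum f i) :=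
  measurable_tsum_ennreal fun k => hf.comp ((measurable_line_sigmaOf hl).prodMk
    ((measurable_pos_sigmaOf hv k).prodMk (measurable_gain_sigmaOf (hg k))))

end RoadNetwork

/-- Laplace functional of a road with parameters `l` whose vehicles carry exponential gains:
the mean of `exp (-∑ f l t h)` over its vehicles at positions `t` with gains `h`. -/
def roadLaplace (mu : ℝ) (f : ℝ × ℝ → ℝ → ℝ → ℝ≥0∞) (l : ℝ × ℝ) : ℝ≥0∞ :=
  expNeg (∫⁻ t, (1 - ∫⁻ h, expNeg (f l t h) ∂(expMeasure 1)) ∂(ENNReal.ofReal mu • volume))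

lemma roadLaplace_le_one (mu : ℝ) (f : ℝ × ℝ → ℝ → ℝ → ℝ≥0∞) (l : ℝ × ℝ) :
    roadLaplace mu f l ≤ 1 := expNeg_le_one _

lemma measurable_lintegral_expNeg_gain {f : ℝ × ℝ → ℝ → ℝ → ℝ≥0∞}
    (hf : Measurable fun p : (ℝ × ℝ) × ℝ × ℝ => f p.1 p.2.1 p.2.2) :
    Measurable fun p : (ℝ × ℝ) × ℝ => ∫⁻ h, expNeg (f p.1 p.2 h) ∂(expMeasure 1) := by
  have h1 : Measurable fun q : ((ℝ × ℝ) × ℝ) × ℝ => (q.1.1, q.1.2, q.2) := by fun_prop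
  exact (measurable_expNeg.comp (hf.comp h1)).lintegral_prod_right'

lemma measurable_roadLaplace (mu : ℝ) {f : ℝ × ℝ → ℝ → ℝ → ℝ≥0∞}
    (hf : Measurable fun p : (ℝ × ℝ) × ℝ × ℝ => f p.1 p.2.1 p.2.2) :
    Measurable (roadLaplace mu f) :=
  measurable_expNeg.comp
    (measurable_const.sub (measurable_lintegral_expNeg_gain hf)).lintegral_prod_right'

namespace IsPoissonRoadNetwork

variable {Ω : Type*} [mΩ : MeasurableSpace Ω] {N : RoadNetwork Ω} {P : Measure Ω} {lam mu : ℝ}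

lemma sigma_le (hN : IsPoissonRoadNetwork N P lam mu) (s : Source) : N.sigma s ≤ mΩ := by
  cases s with
  | roads => exact (measurable_pi_lambda _ hN.roads.measurable).comap_le
  | vehicles i => exact (measurable_pi_lambda _ (hN.vehicles i).measurable).comap_le
  | gain i k => exact (hN.gain_measurable i k).comap_le
  | link => exact hN.link_measurable.comap_le

lemma sigmaOf_le (hN : IsPoissonRoadNetwork N P lam mu) (S : Set Source) : N.sigmaOf S ≤ mΩ :=
  iSup₂_le fun s _ => hN.sigma_le s

lemma indep_sigmaOf (hN : IsPoissonRoadNetwork N P lam mu) {S T : Set Source}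
    (h : Disjoint S T) : Indep (N.sigmaOf S) (N.sigmaOf T) P :=
  indep_iSup_of_disjoint hN.sigma_le hN.indep h

lemma measurable_line (hN : IsPoissonRoadNetwork N P lam mu) (i : Option ℕ) :
    Measurable fun ω => N.line ω i :=
  (RoadNetwork.measurable_line_sigmaOf (S := univ) fun _ => trivial).mono (hN.sigmaOf_le _) le_rfl

lemma measurable_roadSum (hN : IsPoissonRoadNetwork N P lam mu) {f : ℝ × ℝ → ℝ → ℝ → ℝ≥0∞}
    (hf : Measurable fun p : (ℝ × ℝ) × ℝ × ℝ => f p.1 p.2.1 p.2.2) (i : Option ℕ) :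
    Measurable (N.roadSum f i) :=
  (RoadNetwork.measurable_roadSum_sigmaOf (S := univ) hf (fun _ => trivial) trivial
    fun _ => trivial).mono (hN.sigmaOf_le _) le_rfl

/-- The typical road and the other roads contribute independently. -/
lemma lintegral_expNeg_mul_expNeg (hN : IsPoissonRoadNetwork N P lam mu)
    {f g : ℝ × ℝ → ℝ → ℝ → ℝ≥0∞}
    (hf : Measurable fun p : (ℝ × ℝ) × ℝ × ℝ => f p.1 p.2.1 p.2.2)
    (hg : Measurable fun p : (ℝ × ℝ) × ℝ × ℝ => g p.1 p.2.1 p.2.2) :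
    ∫⁻ ω, expNeg (∑' n, N.roadSum f (some n) ω) * expNeg (N.roadSum g none ω) ∂P
      = (∫⁻ ω, expNeg (∑' n, N.roadSum f (some n) ω) ∂P)
        * ∫⁻ ω, expNeg (N.roadSum g none ω) ∂P := by
  let T : Set Source := {s | s = .vehicles none ∨ ∃ k, s = .gain none k}
  refine lintegral_mul_eq_lintegral_mul_lintegral_of_independent_measurableSpace
    (hN.sigmaOf_le Tᶜ) (hN.sigmaOf_le T) (hN.indep_sigmaOf disjoint_compl_left)
    (measurable_expNeg.comp (measurable_tsum_ennreal fun n => ?_))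
    (measurable_expNeg.comp ?_)
  · refine RoadNetwork.measurable_roadSum_sigmaOf hf (fun _ => ?_) ?_ (fun k => ?_) <;>
    · rintro (h | ⟨j, h⟩) <;> cases h
  · exact RoadNetwork.measurable_roadSum_sigmaOf hg (fun h => absurd rfl h) (Or.inl rfl)
      (fun k => Or.inr ⟨k, rfl⟩)

variable [IsProbabilityMeasure P]

/-- For a road in fixed position the gains are independent marks of its vehicles. -/
lemma lintegral_expNeg_fixed_road (hN : IsPoissonRoadNetwork N P lam mu)
    {f : ℝ × ℝ → ℝ → ℝ → ℝ≥0∞}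
    (hf : Measurable fun p : (ℝ × ℝ) × ℝ × ℝ => f p.1 p.2.1 p.2.2) (i : Option ℕ) (l : ℝ × ℝ) :
    ∫⁻ ω, expNeg (∑' k, f l (N.pos i k ω) (N.gain i k ω)) ∂P = roadLaplace mu f l := by
  let S (k : ℕ) : Set Source := {s | s = .vehicles i ∨ ∃ j < k, s = .gain i j}
  have hfl : Measurable fun p : ℝ × ℝ => f l p.1 p.2 := hf.comp measurable_prodMk_left
  have hφ : Measurable fun t => ∫⁻ h, expNeg (f l t h) ∂(expMeasure 1) :=
    (measurable_lintegral_expNeg_gain hf).comp measurable_prodMk_left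
  have h1 := lintegral_expNeg_tsum_marks (P := P) (Y := fun ω k => N.pos i k ω)
    (Z := fun k => N.gain i k) (G := fun k => N.sigmaOf (S k)) (fun k => hN.sigmaOf_le _)
    (fun k => RoadNetwork.measurable_posSeq_sigmaOf (Or.inl rfl))
    (fun j k hjk => RoadNetwork.measurable_gain_sigmaOf (Or.inr ⟨j, hjk, rfl⟩))
    (fun k => hN.gain_measurable i k)
    (fun k => by
      refine indep_of_indep_of_le_right
        (hN.indep_sigmaOf (T := {Source.gain i k}) ?_)
        (RoadNetwork.sigma_le_sigmaOf (N := N) (s := Source.gain i k) (mem_singleton _))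
      rw [Set.disjoint_singleton_right]
      rintro (h | ⟨j, hj, h⟩)
      · cases h
      · cases h; exact lt_irrefl _ hj)
    (f := fun k y h => f l (y k) h)
    (fun k => by
      have : Measurable fun p : (ℕ → ℝ) × ℝ => (p.1 k, p.2) := by fun_prop
      exact hfl.comp this)
  rw [h1]
  have h2 (t : ℝ) (k : ℕ) : ∫⁻ ω', expNeg (f l t (N.gain i k ω')) ∂P
      = ∫⁻ h, expNeg (f l t h) ∂(expMeasure 1) := by
    rw [← hN.gain_law i k]
    exact (lintegral_map (measurable_expNeg.comp (hfl.comp measurable_prodMk_left))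
      (hN.gain_measurable i k)).symm
  simp_rw [h2]
  refine ((hN.vehicles i).lintegral_expNeg_tsum (measurable_negLog.comp hφ)).trans ?_
  rw [roadLaplace]
  congr 1
  refine lintegral_congr fun t => ?_
  rw [Function.comp_apply, expNeg_negLog]
  exact (lintegral_mono fun h => expNeg_le_one _).trans (by simp)

lemma lintegral_expNeg_typical_road (hN : IsPoissonRoadNetwork N P lam mu)
    {f : ℝ × ℝ → ℝ → ℝ → ℝ≥0∞}
    (hf : Measurable fun p : (ℝ × ℝ) × ℝ × ℝ => f p.1 p.2.1 p.2.2) :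
    ∫⁻ ω, expNeg (N.roadSum f none ω) ∂P = roadLaplace mu f (N.angle, 0) :=
  hN.lintegral_expNeg_fixed_road hf none (N.angle, 0)

/-- The vehicles of the roads, together with their gains, are independent marks of the road
process. -/
lemma lintegral_expNeg_other_roads (hN : IsPoissonRoadNetwork N P lam mu)
    {f : ℝ × ℝ → ℝ → ℝ → ℝ≥0∞}
    (hf : Measurable fun p : (ℝ × ℝ) × ℝ × ℝ => f p.1 p.2.1 p.2.2) :
    ∫⁻ ω, expNeg (∑' n, N.roadSum f (some n) ω) ∂P
      = expNeg (∫⁻ l, (1 - roadLaplace mu f l) ∂(ENNReal.ofReal lam •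
          (volume : Measure (ℝ × ℝ)).restrict (Icc 0 Real.pi ×ˢ univ))) := by
  let S (n : ℕ) : Set Source :=
    {s | s = .roads ∨ ∃ j < n, s = .vehicles (some j) ∨ ∃ k, s = .gain (some j) k}
  let T (n : ℕ) : Set Source := {s | s = .vehicles (some n) ∨ ∃ k, s = .gain (some n) k}
  have hZ (n : ℕ) (U : Set Source) (hU : T n ⊆ U) : Measurable[N.sigmaOf U]
      fun ω => ((fun k => N.pos (some n) k ω, fun k => N.gain (some n) k ω) :
        (ℕ → ℝ) × (ℕ → ℝ)) :=
    (RoadNetwork.measurable_posSeq_sigmaOf (hU (Or.inl rfl))).prodMk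
      (RoadNetwork.measurable_gainSeq_sigmaOf fun k => hU (Or.inr ⟨k, rfl⟩))
  have h1 := lintegral_expNeg_tsum_marks (P := P) (Y := fun ω n => N.road n ω)
    (Z := fun n ω => ((fun k => N.pos (some n) k ω, fun k => N.gain (some n) k ω) :
        (ℕ → ℝ) × (ℕ → ℝ)))
    (G := fun n => N.sigmaOf (S n)) (fun n => hN.sigmaOf_le _)
    (fun n => RoadNetwork.measurable_roadSeq_sigmaOf (Or.inl rfl))
    (fun j n hjn => hZ j _ fun s hs => Or.inr ⟨j, hjn, hs⟩)
    (fun n => (hZ n _ Subset.rfl).mono (hN.sigmaOf_le _) le_rfl)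
    (fun n => by
      refine indep_of_indep_of_le_right
        (hN.indep_sigmaOf (T := T n) ?_) (hZ n _ Subset.rfl).comap_le
      rw [Set.disjoint_left]
      rintro s (rfl | ⟨j, hj, rfl | ⟨k, rfl⟩⟩) (h | ⟨k', h⟩) <;> cases h <;>
        exact lt_irrefl _ hj)
    (f := fun n y z => ∑' k, f (y n) (z.1 k) (z.2 k))
    (fun n => Measurable.tsum fun k => by
      have : Measurable fun p : (ℕ → ℝ × ℝ) × (ℕ → ℝ) × (ℕ → ℝ) =>
        (p.1 n, p.2.1 k, p.2.2 k) := by fun_prop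
      exact hf.comp this)
  refine h1.trans ?_
  simp_rw [hN.lintegral_expNeg_fixed_road hf]
  refine (hN.roads.lintegral_expNeg_tsum
    (measurable_negLog.comp (measurable_roadLaplace mu hf))).trans ?_
  congr 1
  refine lintegral_congr fun l => ?_
  rw [Function.comp_apply, expNeg_negLog (roadLaplace_le_one mu f l)]

end IsPoissonRoadNetwork

/-! ### Integrals of even functions, and the exponential distribution -/

lemma lintegral_comp_abs_eq (G : ℝ → ℝ≥0∞) :
    ∫⁻ x, G |x| = 2 * ∫⁻ x in Ioi (0 : ℝ), G x := by
  have h1 : ∫⁻ x in Ioi (0 : ℝ), G |x| = ∫⁻ x in Ioi (0 : ℝ), G x :=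
    setLIntegral_congr_fun measurableSet_Ioi fun x hx => by
      simp only [abs_of_pos (mem_Ioi.1 hx)]
  have h2 : ∫⁻ x in Iic (0 : ℝ), G |x| = ∫⁻ x in Ioi (0 : ℝ), G |x| := by
    have := (Measure.measurePreserving_neg (volume : Measure ℝ)).setLIntegral_comp_preimage_emb
      (MeasurableEquiv.neg ℝ).measurableEmbedding (fun x => G |x|) (Ioi 0)
    simp only [abs_neg] at this
    rw [← this, setLIntegral_congr Iio_ae_eq_Iic.symm]
    congr 2
    ext; simp
  rw [← lintegral_add_compl _ (measurableSet_Ioi (a := (0 : ℝ))), compl_Ioi, h2, h1, two_mul]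

/-- Integral of an even function of the distance against the intensity of the road process. -/
lemma lintegral_road_intensity {lam : ℝ} {F : ℝ → ℝ≥0∞} (hF : Measurable F) :
    ∫⁻ l, F |l.2| ∂(ENNReal.ofReal lam •
        (volume : Measure (ℝ × ℝ)).restrict (Icc 0 Real.pi ×ˢ univ))
      = ENNReal.ofReal (2 * Real.pi * lam) * ∫⁻ y in Ioi (0 : ℝ), F y := by
  have hFa : Measurable fun p : ℝ × ℝ => F |p.2| := hF.comp (by fun_prop)
  rw [lintegral_smul_measure, Measure.volume_eq_prod, ← Measure.prod_restrict,
    lintegral_prod _ hFa.aemeasurable]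
  simp only [lintegral_const, Measure.restrict_univ, lintegral_comp_abs_eq, smul_eq_mul,
    Measure.restrict_apply_univ, Real.volume_Icc, sub_zero]
  rw [mul_assoc 2 Real.pi lam, ENNReal.ofReal_mul zero_le_two, ENNReal.ofReal_mul Real.pi_pos.le,
    ENNReal.ofReal_ofNat]
  ring

/-- Laplace transform of the exponential distribution: the tilted density is, up to the factor
`1 / (1 + c)`, the density of the exponential distribution with rate `1 + c`. -/
lemma lintegral_expNeg_expMeasure {c : ℝ} (hc : 0 ≤ c) :
    ∫⁻ h, expNeg (ENNReal.ofReal (c * h)) ∂(expMeasure 1) = ENNReal.ofReal (1 / (1 + c)) := by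
  have hm : Measurable fun h : ℝ => expNeg (ENNReal.ofReal (c * h)) :=
    measurable_expNeg.comp (by fun_prop)
  have hpdf (r : ℝ) : Measurable (exponentialPDF r) :=
    (measurable_exponentialPDFReal r).ennreal_ofReal
  change ∫⁻ h, _ ∂(volume.withDensity (exponentialPDF 1)) = _
  rw [lintegral_withDensity_eq_lintegral_mul _ (hpdf 1) hm]
  have h1 (h : ℝ) : (exponentialPDF 1 * fun h => expNeg (ENNReal.ofReal (c * h))) h
      = ENNReal.ofReal (1 / (1 + c)) * exponentialPDF (1 + c) h := by
    rcases lt_or_ge h 0 with hh | hh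
    · simp [exponentialPDF_of_neg hh]
    · rw [Pi.mul_apply, exponentialPDF_of_nonneg hh, exponentialPDF_of_nonneg hh,
        expNeg_ofReal (by positivity), ← ENNReal.ofReal_mul (by positivity),
        ← ENNReal.ofReal_mul (by positivity)]
      congr 1
      rw [mul_assoc, ← Real.exp_add, ← mul_assoc, one_div,
        inv_mul_cancel₀ (by positivity : (1 + c) ≠ 0)]
      congr 2; ring
  rw [lintegral_congr h1, lintegral_const_mul _ (hpdf _),
    lintegral_exponentialPDF_eq_one (by positivity), mul_one]

lemma expMeasure_Ioi {x : ℝ} (hx : 0 ≤ x) :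
    expMeasure 1 (Ioi x) = ENNReal.ofReal (Real.exp (-x)) := by
  have h1 := cdf_expMeasure_eq one_pos x
  rw [if_pos hx, cdf_eq_real, one_mul] at h1
  rw [← compl_Iic, ← ofReal_measureReal, probReal_compl_eq_one_sub measurableSet_Iic, h1]
  congr 1; ring

/-! ### Laplace transforms of the interferences -/

namespace RoadNetwork

variable {Ω : Type*} (N : RoadNetwork Ω)

lemma norm_loc (i : Option ℕ) (k : ℕ) (ω : Ω) :
    ‖N.loc i k ω‖ = Real.sqrt ((N.line ω i).2 ^ 2 + N.pos i k ω ^ 2) := by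
  rw [EuclideanSpace.norm_eq, Fin.sum_univ_two]
  congr 1
  simp only [loc, PiLp.add_apply, PiLp.smul_apply, smul_eq_mul, Matrix.cons_val_zero,
    Matrix.cons_val_one, Real.norm_eq_abs, sq_abs]
  have := Real.sin_sq_add_cos_sq (N.line ω i).1
  simp
  linear_combination ((N.line ω i).2 ^ 2 + N.pos i k ω ^ 2) * this

end RoadNetwork

/-- Contribution `s P_v h d ^ (-α)` of a vehicle at distance `d > r` from the origin, as a function
of the road parameters, the position on the road and the gain. -/
def interferenceTerm (Pv α s r : ℝ) (l : ℝ × ℝ) (t h : ℝ) : ℝ≥0∞ :=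
  if r < Real.sqrt (l.2 ^ 2 + t ^ 2) then
    ENNReal.ofReal s * ENNReal.ofReal (Pv * h * Real.sqrt (l.2 ^ 2 + t ^ 2) ^ (-α)) else 0

lemma measurable_interferenceTerm (Pv α s r : ℝ) :
    Measurable fun p : (ℝ × ℝ) × ℝ × ℝ => interferenceTerm Pv α s r p.1 p.2.1 p.2.2 := by
  refine Measurable.ite (measurableSet_lt measurable_const (by fun_prop)) ?_ measurable_const
  fun_prop

lemma RoadNetwork.mul_roadInterference {Ω : Type*} (N : RoadNetwork Ω) (Pv α s r : ℝ)
    (i : Option ℕ) (ω : Ω) :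
    ENNReal.ofReal s * N.roadInterference Pv α r i ω
      = N.roadSum (interferenceTerm Pv α s r) i ω := by
  rw [roadInterference, ← ENNReal.tsum_mul_left]
  refine tsum_congr fun k => ?_
  rw [interferenceTerm, ← norm_loc, mul_ite, mul_zero]

lemma lt_sqrt_add_sq_iff {r y t : ℝ} (hr : 0 ≤ r) (ht : t ≠ 0) :
    r < Real.sqrt (y ^ 2 + t ^ 2) ↔ Real.sqrt (r ^ 2 - y ^ 2) < |t| := by
  rw [Real.lt_sqrt hr, Real.sqrt_lt' (abs_pos.2 ht), sq_abs, sub_lt_iff_lt_add']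

/-- The interference of one road: outside the disk of radius `r` means at distance more than
`√(r² - y²)` from the foot of the perpendicular, on either side. -/
lemma roadLaplace_interferenceTerm {mu Pv α s r : ℝ} (hPv : 0 < Pv) (hs : 0 < s)
    (hr : 0 < r) (l : ℝ × ℝ) :
    roadLaplace mu (interferenceTerm Pv α s r) l
      = lapRoad mu Pv α s l.2 (Real.sqrt (r ^ 2 - l.2 ^ 2)) := by
  obtain ⟨x, y⟩ := l
  set a := Real.sqrt (r ^ 2 - y ^ 2) with ha
  have ha0 : 0 ≤ a := Real.sqrt_nonneg _
  set H : ℝ → ℝ≥0∞ := fun t =>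
    ENNReal.ofReal (1 - 1 / (1 + s * Pv * (y ^ 2 + t ^ 2) ^ (-α / 2))) with hH
  -- For `|y| ≥ r` the lower limit `a` is `0`, and the foot `t = 0` is a null set.
  have h1 (t : ℝ) (ht : t ≠ 0) :
      1 - ∫⁻ h, expNeg (interferenceTerm Pv α s r (x, y) t h) ∂(expMeasure 1)
        = (Ioi a).indicator H |t| := by
    by_cases hlt : r < Real.sqrt (y ^ 2 + t ^ 2)
    · rw [indicator_of_mem (by rwa [mem_Ioi, ← lt_sqrt_add_sq_iff hr.le ht])]
      have h0 : 0 ≤ y ^ 2 + t ^ 2 := by positivity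
      have hd : Real.sqrt (y ^ 2 + t ^ 2) ^ (-α) = (y ^ 2 + t ^ 2) ^ (-α / 2) := by
        rw [Real.sqrt_eq_rpow, ← Real.rpow_mul h0]; congr 1; ring
      have hc : 0 ≤ s * Pv * (y ^ 2 + t ^ 2) ^ (-α / 2) := by positivity
      have h2 (h : ℝ) : interferenceTerm Pv α s r (x, y) t h
          = ENNReal.ofReal (s * Pv * (y ^ 2 + t ^ 2) ^ (-α / 2) * h) := by
        rw [interferenceTerm, if_pos hlt, ← ENNReal.ofReal_mul hs.le, hd]
        congr 1; ring
      simp_rw [h2]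
      rw [lintegral_expNeg_expMeasure hc, ← ENNReal.ofReal_one,
        ← ENNReal.ofReal_sub _ (by positivity), hH]
      simp only [sq_abs]
    · rw [indicator_of_notMem (by rwa [mem_Ioi, ← lt_sqrt_add_sq_iff hr.le ht])]
      have h2 (h : ℝ) : interferenceTerm Pv α s r (x, y) t h = 0 := by
        rw [interferenceTerm, if_neg hlt]
      simp [h2]
  have h3 : ∫⁻ t, (1 - ∫⁻ h, expNeg (interferenceTerm Pv α s r (x, y) t h) ∂(expMeasure 1))
      = 2 * ∫⁻ t in Ioi a, H t := by
    have hne : ∀ᵐ t : ℝ, t ≠ 0 := by simp [ae_iff]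
    rw [lintegral_congr_ae (hne.mono h1), lintegral_comp_abs_eq,
      setLIntegral_indicator measurableSet_Ioi, Ioi_inter_Ioi, sup_of_le_left ha0]
  rw [roadLaplace, lapRoad, lintegral_smul_measure, h3, smul_eq_mul, ← mul_assoc,
    ENNReal.ofReal_mul zero_le_two, ENNReal.ofReal_ofNat, mul_comm 2]

namespace IsPoissonRoadNetwork

variable {Ω : Type*} [mΩ : MeasurableSpace Ω] {N : RoadNetwork Ω} {P : Measure Ω} {lam mu : ℝ}

lemma laplace_Iv_eq (N : RoadNetwork Ω) (P : Measure Ω) (Pv α r s : ℝ) :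
    laplace P (N.Iv Pv α r) s
      = ∫⁻ ω, expNeg (∑' n, N.roadSum (interferenceTerm Pv α s r) (some n) ω) ∂P := by
  simp_rw [laplace, RoadNetwork.Iv, ← ENNReal.tsum_mul_left, RoadNetwork.mul_roadInterference]

lemma laplace_Ir_eq (N : RoadNetwork Ω) (P : Measure Ω) (Pv α r s : ℝ) :
    laplace P (N.Ir Pv α r) s
      = ∫⁻ ω, expNeg (N.roadSum (interferenceTerm Pv α s r) none ω) ∂P := by
  simp_rw [laplace, RoadNetwork.Ir, RoadNetwork.mul_roadInterference]

variable [IsProbabilityMeasure P]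

theorem laplace_Iv (hN : IsPoissonRoadNetwork N P lam mu) {Pv α r s : ℝ} (hPv : 0 < Pv)
    (hr : 0 < r) (hs : 0 < s) :
    laplace P (N.Iv Pv α r) s = lapIv lam mu Pv α s r := by
  have hm := measurable_interferenceTerm Pv α s r
  rw [laplace_Iv_eq, hN.lintegral_expNeg_other_roads hm]
  have hF : Measurable fun y : ℝ => 1 - roadLaplace mu (interferenceTerm Pv α s r) (0, y) :=
    measurable_const.sub ((measurable_roadLaplace mu hm).comp measurable_prodMk_left)
  have h1 (l : ℝ × ℝ) : 1 - roadLaplace mu (interferenceTerm Pv α s r) l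
      = 1 - roadLaplace mu (interferenceTerm Pv α s r) (0, |l.2|) := by
    simp only [roadLaplace_interferenceTerm hPv hs hr, lapRoad, sq_abs]
  rw [lintegral_congr h1, lintegral_road_intensity hF, ← Ioc_union_Ioi_eq_Ioi hr.le,
    lintegral_union measurableSet_Ioi Ioc_disjoint_Ioi_same, mul_add, expNeg_add, lapIv]
  simp_rw [roadLaplace_interferenceTerm hPv hs hr]
  congr 3
  -- Beyond `r` the square root vanishes, so that all vehicles of the road interfere.
  refine setLIntegral_congr_fun measurableSet_Ioi fun y hy => ?_
  have : r ^ 2 - y ^ 2 ≤ 0 := by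
    have := mem_Ioi.1 hy
    nlinarith
  simp only [lapOut, Real.sqrt_eq_zero_of_nonpos this]

lemma laplace_Ir_eq_lapRoad (hN : IsPoissonRoadNetwork N P lam mu) {Pv α r s : ℝ} (hPv : 0 < Pv)
    (hr : 0 < r) (hs : 0 < s) :
    laplace P (N.Ir Pv α r) s = lapRoad mu Pv α s 0 r := by
  rw [laplace_Ir_eq, hN.lintegral_expNeg_typical_road (measurable_interferenceTerm Pv α s r),
    roadLaplace_interferenceTerm hPv hs hr]
  simp [Real.sqrt_sq hr.le]

end IsPoissonRoadNetwork

/-! ### The typical road in closed form -/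

/-- The hypergeometric function of the closed form: here `c - b = 1`, so one factor of Euler's
integrand disappears and the Gamma quotient is `b`. -/
lemma hyp2F1_one_eq {α z : ℝ} (hα : 1 < α) :
    hyp2F1 1 ((α - 1) / α) (2 - 1 / α) (-z)
      = (α - 1) / α * ∫ v in (0 : ℝ)..1, v ^ (-1 / α) * (1 + z * v)⁻¹ := by
  have hα0 : 0 < α := by linarith
  have hb : (α - 1) / α ≠ 0 := (div_pos (by linarith) hα0).ne'
  have hc : 2 - 1 / α = (α - 1) / α + 1 := by field_simp; ring
  have hb1 : (α - 1) / α - 1 = -1 / α := by field_simp; ring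
  rw [hyp2F1, hc, add_sub_cancel_left, Real.Gamma_one, mul_one, Real.Gamma_add_one hb,
    mul_div_cancel_right₀ _ (Real.Gamma_pos_of_pos (div_pos (by linarith) hα0)).ne', sub_self, hb1]
  congr 2; ext v
  rw [Real.rpow_zero, mul_one, Real.rpow_neg_one]
  congr 2; ring

lemma intervalIntegrable_rpow_mul_inv {α z : ℝ} (hα : 1 < α) (hz : 0 < z) :
    IntervalIntegrable (fun v : ℝ => v ^ (-1 / α) * (1 + z * v)⁻¹) volume 0 1 := by
  have hα0 : 0 < α := by linarith
  refine IntervalIntegrable.mul_continuousOn (intervalIntegral.intervalIntegrable_rpow' ?_) ?_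
  · rw [neg_div, neg_lt_neg_iff, div_lt_one hα0]; exact hα
  · refine ContinuousOn.inv₀ (by fun_prop) fun v hv => ?_
    rw [uIcc_of_le zero_le_one] at hv
    have := mul_nonneg hz.le hv.1
    positivity

/-- The substitution `t = r v ^ (-1 / α)` maps `0 < v < 1` onto `t > r` and turns the path loss
`(t / r) ^ (-α)` into `v`. -/
lemma lintegral_typical_road {α z r : ℝ} (hα : 1 < α) (hz : 0 < z) (hr : 0 < r) :
    ∫⁻ t in Ioi r, ENNReal.ofReal (1 - 1 / (1 + z * r ^ α * t ^ (-α)))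
      = ENNReal.ofReal (r * z / α * ∫ v in (0 : ℝ)..1, v ^ (-1 / α) * (1 + z * v)⁻¹) := by
  have hα0 : 0 < α := by linarith
  have himg : (fun v : ℝ => r * v ^ (-1 / α)) '' Ioo 0 1 = Ioi r := by
    ext t
    constructor
    · rintro ⟨v, hv, rfl⟩
      rw [mem_Ioi]
      exact lt_mul_of_one_lt_right hr (Real.one_lt_rpow_of_pos_of_lt_one_of_neg hv.1 hv.2
        (div_neg_of_neg_of_pos (by norm_num) hα0))
    · intro ht
      have ht0 : 0 < t := hr.trans ht
      have h1 : 1 < t / r := (one_lt_div hr).2 ht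
      refine ⟨(t / r) ^ (-α), ⟨by positivity,
        Real.rpow_lt_one_of_one_lt_of_neg h1 (by linarith)⟩, ?_⟩
      simp only
      rw [← Real.rpow_mul (by positivity), show -α * (-1 / α) = 1 by field_simp, Real.rpow_one,
        mul_div_cancel₀ _ hr.ne']
  have hderiv (v : ℝ) (hv : v ∈ Ioo (0 : ℝ) 1) : HasDerivWithinAt (fun v : ℝ => r * v ^ (-1 / α))
      (r * (-1 / α * v ^ (-1 / α - 1))) (Ioo 0 1) v :=
    ((Real.hasDerivAt_rpow_const (Or.inl hv.1.ne')).const_mul r).hasDerivWithinAt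
  have hinj : InjOn (fun v : ℝ => r * v ^ (-1 / α)) (Ioo 0 1) := by
    intro v hv w hw h
    have h1 : v ^ (-1 / α) = w ^ (-1 / α) := mul_left_cancel₀ hr.ne' h
    have h2 := congrArg (fun x : ℝ => x ^ (-α)) h1
    rwa [← Real.rpow_mul hv.1.le, ← Real.rpow_mul hw.1.le, show -1 / α * -α = 1 by field_simp,
      Real.rpow_one, Real.rpow_one] at h2
  rw [← himg, lintegral_image_eq_lintegral_abs_deriv_mul measurableSet_Ioo hderiv hinj,
    ← intervalIntegral.integral_const_mul, intervalIntegral.integral_of_le zero_le_one,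
    integral_Ioc_eq_integral_Ioo, ofReal_integral_eq_lintegral_ofReal]
  · refine setLIntegral_congr_fun measurableSet_Ioo fun v hv => ?_
    have hv0 := hv.1
    have h1 : (r * v ^ (-1 / α)) ^ (-α) = r ^ (-α) * v := by
      rw [Real.mul_rpow hr.le (by positivity), ← Real.rpow_mul hv0.le,
        show -1 / α * -α = 1 by field_simp, Real.rpow_one]
    have h2 : z * r ^ α * (r * v ^ (-1 / α)) ^ (-α) = z * v := by
      rw [h1, Real.rpow_neg hr.le]
      field_simp
    have h3 : |r * (-1 / α * v ^ (-1 / α - 1))| = r / α * (v ^ (-1 / α) / v) := by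
      rw [Real.rpow_sub_one hv0.ne', abs_mul, abs_mul, abs_of_pos hr, neg_div, abs_neg,
        abs_of_pos (by positivity : 0 < 1 / α),
        abs_of_pos (by positivity : 0 < v ^ (-(1 / α)) / v)]
      ring
    simp only [h2, h3]
    rw [← ENNReal.ofReal_mul (by positivity)]
    congr 1
    field_simp
    ring
  · have := (intervalIntegrable_rpow_mul_inv hα hz).const_mul (r * z / α)
    exact (intervalIntegrable_iff_integrableOn_Ioo_of_le zero_le_one).1 this
  · refine (ae_restrict_iff' measurableSet_Ioo).2 (.of_forall fun v hv => ?_)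
    have := hv.1
    simp only [Pi.zero_apply]
    positivity

lemma lapRoad_typical_road {mu Pv α z r : ℝ} (hmu : 0 < mu) (hPv : 0 < Pv) (hα : 1 < α)
    (hz : 0 < z) (hr : 0 < r) :
    lapRoad mu Pv α (z / (Pv * r ^ (-α))) 0 r = lapIr mu α z r := by
  have h1 : ∫⁻ t in Ioi r, ENNReal.ofReal (1 - 1 / (1 + z / (Pv * r ^ (-α)) * Pv
      * ((0 : ℝ) ^ 2 + t ^ 2) ^ (-α / 2)))
      = ∫⁻ t in Ioi r, ENNReal.ofReal (1 - 1 / (1 + z * r ^ α * t ^ (-α))) := by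
    refine setLIntegral_congr_fun measurableSet_Ioi fun t ht => ?_
    have ht0 : 0 < t := hr.trans ht
    have h2 : ((0 : ℝ) ^ 2 + t ^ 2) ^ (-α / 2) = t ^ (-α) := by
      rw [zero_pow two_ne_zero, zero_add, ← Real.rpow_natCast, ← Real.rpow_mul ht0.le]
      congr 1; push_cast; ring
    have h3 : z / (Pv * r ^ (-α)) * Pv = z * r ^ α := by
      rw [Real.rpow_neg hr.le]; field_simp
    simp only [h2, h3]
  have hI : 0 ≤ ∫ v in (0 : ℝ)..1, v ^ (-1 / α) * (1 + z * v)⁻¹ :=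
    intervalIntegral.integral_nonneg zero_le_one fun v hv => by
      have := hv.1
      positivity
  have hα0 : 0 < α := by linarith
  have hα1 : α - 1 ≠ 0 := by linarith
  rw [lapRoad, h1, lintegral_typical_road hα hz hr, ← ENNReal.ofReal_mul (by positivity),
    expNeg_ofReal (by positivity), lapIr, hyp2F1_one_eq hα]
  congr 3
  field_simp

/-! ### The nearest-vehicle density as a derivative -/

section Density

/-- Mean of `1 - exp (-c √(1 - x²))` over `0 ≤ x ≤ 1`: the probability that a road hitting the disk
of radius `r` carries a vehicle in the disk, with `c = 2 μ r`. -/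
def chordMean (c : ℝ) : ℝ := ∫ x in (0 : ℝ)..1, (1 - Real.exp (-c * Real.sqrt (1 - x ^ 2)))

/-- Derivative of `chordMean`. -/
def chordMeanDeriv (c : ℝ) : ℝ :=
  ∫ x in (0 : ℝ)..1, Real.sqrt (1 - x ^ 2) * Real.exp (-c * Real.sqrt (1 - x ^ 2))

lemma sqrt_one_sub_sq_le_one (x : ℝ) : Real.sqrt (1 - x ^ 2) ≤ 1 :=
  Real.sqrt_le_one.2 (by nlinarith [sq_nonneg x])

lemma hasDerivAt_chordMean (c : ℝ) : HasDerivAt chordMean (chordMeanDeriv c) c := by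
  refine (intervalIntegral.hasDerivAt_integral_of_dominated_loc_of_deriv_le
    (F := fun c x => 1 - Real.exp (-c * Real.sqrt (1 - x ^ 2)))
    (F' := fun c x => Real.sqrt (1 - x ^ 2) * Real.exp (-c * Real.sqrt (1 - x ^ 2)))
    (bound := fun _ => Real.exp (|c| + 1)) (Metric.ball_mem_nhds c one_pos)
    (.of_forall fun _ => (Continuous.aestronglyMeasurable (by fun_prop)))
    (Continuous.intervalIntegrable (by fun_prop) _ _)
    (Continuous.aestronglyMeasurable (by fun_prop)) ?_ (by simp) ?_).2
  · refine .of_forall fun x _ c' hc' => ?_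
    have h0 := Real.sqrt_nonneg (1 - x ^ 2)
    have h1 := sqrt_one_sub_sq_le_one x
    rw [Metric.mem_ball, Real.dist_eq] at hc'
    have h2 : -c' ≤ |c| + 1 := by
      have := abs_lt.1 hc'
      have := neg_abs_le c
      linarith
    rw [norm_mul, Real.norm_of_nonneg h0, Real.norm_of_nonneg (Real.exp_pos _).le]
    refine (mul_le_of_le_one_left (Real.exp_pos _).le h1).trans (Real.exp_le_exp.2 ?_)
    have : 0 ≤ |c| + 1 := by positivity
    nlinarith
  · refine .of_forall fun x _ c' _ => ?_
    have := (((hasDerivAt_id c').neg.mul_const (Real.sqrt (1 - x ^ 2))).exp).const_sub 1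
    convert! this using 1
    simp only [Pi.neg_apply, id]
    ring

lemma intervalIntegrable_inv_sqrt_one_sub_sq :
    IntervalIntegrable (fun x : ℝ => 1 / Real.sqrt (1 - x ^ 2)) volume 0 1 := by
  refine intervalIntegral.intervalIntegrable_deriv_of_nonneg (g := Real.arcsin)
    Real.continuous_arcsin.continuousOn (fun x hx => ?_) (fun x _ => by positivity)
  simp only [zero_le_one, inf_of_le_left, sup_of_le_right, mem_Ioo] at hx
  exact Real.hasDerivAt_arcsin (by linarith [hx.1]) (by linarith [hx.2])

lemma intervalIntegrable_exp_div_sqrt {c : ℝ} (hc : 0 ≤ c) :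
    IntervalIntegrable (fun x : ℝ => Real.exp (-c * Real.sqrt (1 - x ^ 2)) / Real.sqrt (1 - x ^ 2))
      volume 0 1 := by
  refine intervalIntegrable_inv_sqrt_one_sub_sq.mono_fun'
    (Measurable.aestronglyMeasurable (by fun_prop)) (.of_forall fun x => ?_)
  have h0 := Real.sqrt_nonneg (1 - x ^ 2)
  simp only [norm_div, Real.norm_of_nonneg h0, Real.norm_of_nonneg (Real.exp_pos _).le]
  gcongr
  exact Real.exp_le_one_iff.2 (by nlinarith)

/-- Integration by parts: `x (exp (-c √(1 - x²)) - 1)` vanishes at both ends of `[0, 1]`. -/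
lemma chordMean_add_mul_deriv {c : ℝ} (hc : 0 ≤ c) :
    chordMean c + c * chordMeanDeriv c
      = c * ∫ x in (0 : ℝ)..1,
          Real.exp (-c * Real.sqrt (1 - x ^ 2)) / Real.sqrt (1 - x ^ 2) := by
  have hi1 : IntervalIntegrable (fun x : ℝ => 1 - Real.exp (-c * Real.sqrt (1 - x ^ 2)))
      volume 0 1 := Continuous.intervalIntegrable (by fun_prop) _ _
  have hi2 : IntervalIntegrable (fun x : ℝ => c * (Real.sqrt (1 - x ^ 2)
      * Real.exp (-c * Real.sqrt (1 - x ^ 2)))) volume 0 1 :=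
    Continuous.intervalIntegrable (by fun_prop) _ _
  have hi3 := (intervalIntegrable_exp_div_sqrt hc).const_mul c
  rw [chordMean, chordMeanDeriv, ← intervalIntegral.integral_const_mul,
    ← intervalIntegral.integral_const_mul, ← sub_eq_zero, ← neg_eq_zero,
    ← intervalIntegral.integral_add hi1 hi2, ← intervalIntegral.integral_sub (hi1.add hi2) hi3,
    ← intervalIntegral.integral_neg]
  refine (intervalIntegral.integral_eq_sub_of_hasDerivAt_of_le
    (f := fun x => x * (Real.exp (-c * Real.sqrt (1 - x ^ 2)) - 1)) zero_le_one
    (Continuous.continuousOn (by fun_prop)) (fun x hx => ?_) ((hi1.add hi2).sub hi3).neg).trans ?_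
  · have hpos : 0 < 1 - x ^ 2 := by nlinarith [hx.1, hx.2]
    have hs : 0 < Real.sqrt (1 - x ^ 2) := Real.sqrt_pos.2 hpos
    have hsq : Real.sqrt (1 - x ^ 2) ^ 2 = 1 - x ^ 2 := Real.sq_sqrt hpos.le
    have h1 : HasDerivAt (fun x : ℝ => 1 - x ^ 2) (-(2 * x)) x := by
      simpa using (hasDerivAt_pow 2 x).const_sub 1
    have h2 := (((h1.sqrt hpos.ne').const_mul (-c)).exp.sub_const 1)
    have h3 := (hasDerivAt_id x).mul h2
    convert! h3 using 1
    simp only [id, one_mul, Pi.neg_apply]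
    field_simp
    linear_combination (-c * Real.exp (-(c * Real.sqrt (1 - x ^ 2)))) * hsq
  · simp

lemma sqrt_sq_sub_mul_sq {r : ℝ} (hr : 0 ≤ r) (x : ℝ) :
    Real.sqrt (r ^ 2 - (r * x) ^ 2) = r * Real.sqrt (1 - x ^ 2) := by
  rw [show r ^ 2 - (r * x) ^ 2 = r ^ 2 * (1 - x ^ 2) by ring, Real.sqrt_mul (sq_nonneg r),
    Real.sqrt_sq hr]

lemma integral_zero_eq_mul_integral_zero_one {r : ℝ} (f : ℝ → ℝ) :
    ∫ y in (0 : ℝ)..r, f y = r * ∫ x in (0 : ℝ)..1, f (r * x) := by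
  have := intervalIntegral.mul_integral_comp_mul_left (a := 0) (b := 1) (f := f) r
  rw [this, mul_zero, mul_one]

/-- Probability that no vehicle lies within distance `r` of the origin, for `r ≥ 0`. This form is
differentiable on the whole line, in particular at `0`. -/
def survival (lam mu r : ℝ) : ℝ :=
  Real.exp (-2 * Real.pi * lam * (r * chordMean (2 * mu * r)) - 2 * r * mu)

variable {lam mu r : ℝ}

lemma integral_one_sub_exp_sqrt (hr : 0 ≤ r) :
    ∫ y in (0 : ℝ)..r, (1 - Real.exp (-2 * mu * Real.sqrt (r ^ 2 - y ^ 2)))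
      = r * chordMean (2 * mu * r) := by
  rw [integral_zero_eq_mul_integral_zero_one, chordMean]
  simp_rw [sqrt_sq_sub_mul_sq hr]
  congr 2; ext x; congr 2; ring

lemma integral_exp_sqrt_div_sqrt (hr : 0 < r) :
    ∫ y in (0 : ℝ)..r,
        r * Real.exp (-2 * mu * Real.sqrt (r ^ 2 - y ^ 2)) / Real.sqrt (r ^ 2 - y ^ 2)
      = r * ∫ x in (0 : ℝ)..1, Real.exp (-(2 * mu * r) * Real.sqrt (1 - x ^ 2))
          / Real.sqrt (1 - x ^ 2) := by
  rw [integral_zero_eq_mul_integral_zero_one]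
  simp_rw [sqrt_sq_sub_mul_sq hr.le]
  congr 2; ext x
  rw [mul_div_mul_left _ _ hr.ne']
  congr 2; ring

lemma pdfRv_nonneg (hlam : 0 < lam) (hmu : 0 < mu) (hr : 0 < r) : 0 ≤ pdfRv lam mu r := by
  refine mul_nonneg (add_nonneg (mul_nonneg (by positivity) ?_) (by positivity)) (Real.exp_pos _).le
  exact intervalIntegral.integral_nonneg hr.le fun y _ => by positivity

lemma hasDerivAt_survival_aux (lam mu r : ℝ) :
    HasDerivAt (survival lam mu) (survival lam mu r * (-2 * Real.pi * lam *
      (chordMean (2 * mu * r) + 2 * mu * r * chordMeanDeriv (2 * mu * r)) - 2 * mu)) r := by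
  have h1 : HasDerivAt (fun r => chordMean (2 * mu * r))
      (chordMeanDeriv (2 * mu * r) * (2 * mu)) r :=
    (hasDerivAt_chordMean (2 * mu * r)).comp r (by simpa using (hasDerivAt_id r).const_mul (2 * mu))
  have h2 := (((hasDerivAt_id r).mul h1).const_mul (-2 * Real.pi * lam)).sub
    (((hasDerivAt_id r).const_mul 2).mul_const mu)
  convert! h2.exp using 1
  simp only [id, survival, Pi.mul_apply, Pi.sub_apply]
  ring

lemma hasDerivAt_survival (hmu : 0 < mu) (hr : 0 < r) :
    HasDerivAt (survival lam mu) (-pdfRv lam mu r) r := by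
  convert! hasDerivAt_survival_aux lam mu r using 1
  rw [chordMean_add_mul_deriv (by positivity), pdfRv, integral_exp_sqrt_div_sqrt hr,
    integral_one_sub_exp_sqrt hr.le, survival]
  ring

lemma chordMean_nonneg {c : ℝ} (hc : 0 ≤ c) : 0 ≤ chordMean c :=
  intervalIntegral.integral_nonneg zero_le_one fun x _ => by
    rw [sub_nonneg, Real.exp_le_one_iff]
    nlinarith [Real.sqrt_nonneg (1 - x ^ 2)]

open Filter Topology in
lemma tendsto_survival (hlam : 0 < lam) (hmu : 0 < mu) :
    Tendsto (survival lam mu) atTop (𝓝 0) := by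
  have h1 : Tendsto (fun r : ℝ => Real.exp (-(2 * mu * r))) atTop (𝓝 0) :=
    Real.tendsto_exp_neg_atTop_nhds_zero.comp
      (tendsto_id.const_mul_atTop (by positivity : 0 < 2 * mu))
  refine tendsto_of_tendsto_of_tendsto_of_le_of_le' tendsto_const_nhds h1
    (.of_forall fun r => (Real.exp_pos _).le) ?_
  filter_upwards [eventually_ge_atTop 0] with r hr
  refine Real.exp_le_exp.2 ?_
  have : 0 ≤ Real.pi * lam * (r * chordMean (2 * mu * r)) := by
    have := chordMean_nonneg (c := 2 * mu * r) (by positivity)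
    have := Real.pi_pos
    positivity
  linarith

lemma integrableOn_pdfRv (hlam : 0 < lam) (hmu : 0 < mu) {a : ℝ} (ha : 0 ≤ a) :
    IntegrableOn (pdfRv lam mu) (Ioi a) := by
  have := integrableOn_Ioi_deriv_of_nonpos (a := a)
    (hasDerivAt_survival_aux lam mu a).continuousAt.continuousWithinAt
    (fun x hx => hasDerivAt_survival (lam := lam) hmu (ha.trans_lt hx))
    (fun x hx => neg_nonpos.2 (pdfRv_nonneg hlam hmu (ha.trans_lt hx)))
    (tendsto_survival hlam hmu)
  simpa using this.neg

lemma lintegral_pdfRv (hlam : 0 < lam) (hmu : 0 < mu) {a : ℝ} (ha : 0 ≤ a) :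
    ∫⁻ r in Ioi a, ENNReal.ofReal (pdfRv lam mu r) = ENNReal.ofReal (survival lam mu a) := by
  rw [← ofReal_integral_eq_lintegral_ofReal (integrableOn_pdfRv hlam hmu ha)
    ((ae_restrict_iff' measurableSet_Ioi).2
      (.of_forall fun r hr => pdfRv_nonneg hlam hmu (ha.trans_lt hr)))]
  have := integral_Ioi_of_hasDerivAt_of_nonpos (a := a)
    (hasDerivAt_survival_aux lam mu a).continuousAt.continuousWithinAt
    (fun x hx => hasDerivAt_survival (lam := lam) hmu (ha.trans_lt hx))
    (fun x hx => neg_nonpos.2 (pdfRv_nonneg hlam hmu (ha.trans_lt hx)))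
    (tendsto_survival hlam hmu)
  rw [integral_neg, zero_sub, neg_inj] at this
  rw [this]

end Density

/-! ### Law of the nearest-vehicle distance -/

/-- Infinite weight for the vehicles at distance less than `r` from the origin. -/
def voidTerm (r : ℝ) (l : ℝ × ℝ) (t _h : ℝ) : ℝ≥0∞ :=
  if Real.sqrt (l.2 ^ 2 + t ^ 2) < r then ∞ else 0

lemma measurable_voidTerm (r : ℝ) :
    Measurable fun p : (ℝ × ℝ) × ℝ × ℝ => voidTerm r p.1 p.2.1 p.2.2 :=
  Measurable.ite (measurableSet_lt (by fun_prop) measurable_const) measurable_const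
    measurable_const

lemma roadLaplace_voidTerm {mu r : ℝ} (hmu : 0 < mu) (hr : 0 < r) (l : ℝ × ℝ) :
    roadLaplace mu (voidTerm r) l
      = ENNReal.ofReal (Real.exp (-2 * mu * Real.sqrt (r ^ 2 - l.2 ^ 2))) := by
  obtain ⟨x, y⟩ := l
  set a := Real.sqrt (r ^ 2 - y ^ 2) with ha
  have ha0 : 0 ≤ a := Real.sqrt_nonneg _
  have h1 (t : ℝ) : 1 - ∫⁻ h, expNeg (voidTerm r (x, y) t h) ∂(expMeasure 1)
      = (Iio a).indicator 1 |t| := by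
    have hiff : Real.sqrt (y ^ 2 + t ^ 2) < r ↔ |t| ∈ Iio a := by
      rw [mem_Iio, ha, Real.lt_sqrt (abs_nonneg t), Real.sqrt_lt' hr, sq_abs, lt_sub_iff_add_lt']
    by_cases hlt : |t| ∈ Iio a
    · simp [voidTerm, hiff.2 hlt, indicator_of_mem hlt]
    · simp [voidTerm, mt hiff.1 hlt, indicator_of_notMem hlt]
  rw [roadLaplace, lintegral_smul_measure, lintegral_congr h1, lintegral_comp_abs_eq,
    lintegral_indicator_one measurableSet_Iio, Measure.restrict_apply measurableSet_Iio,
    inter_comm, Ioi_inter_Iio, Real.volume_Ioo, sub_zero, smul_eq_mul, ← ENNReal.ofReal_ofNat 2,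
    ← ENNReal.ofReal_mul zero_le_two, ← ENNReal.ofReal_mul hmu.le, expNeg_ofReal (by positivity)]
  congr 2; ring

namespace RoadNetwork

variable {Ω : Type*} (N : RoadNetwork Ω)

lemma le_nearestDist_iff (r : ℝ) (ω : Ω) :
    r ≤ N.nearestDist ω ↔ ∀ i k, r ≤ ‖N.loc i k ω‖ := by
  rw [nearestDist, le_ciInf_iff ⟨0, by rintro _ ⟨p, rfl⟩; exact norm_nonneg _⟩]
  exact Prod.forall

/-- The exponential of minus the void terms is the indicator of an empty disk. -/
lemma expNeg_voidTerm_eq_indicator (r : ℝ) (ω : Ω) :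
    expNeg (∑' n, N.roadSum (voidTerm r) (some n) ω) * expNeg (N.roadSum (voidTerm r) none ω)
      = {ω | r ≤ N.nearestDist ω}.indicator 1 ω := by
  have hterm (i : Option ℕ) (k : ℕ) : voidTerm r (N.line ω i) (N.pos i k ω) (N.gain i k ω)
      = if ‖N.loc i k ω‖ < r then ∞ else 0 := by rw [voidTerm, norm_loc]
  by_cases h : r ≤ N.nearestDist ω
  · have h0 (i : Option ℕ) : N.roadSum (voidTerm r) i ω = 0 := by
      simp_rw [roadSum, hterm, if_neg (not_lt.2 ((N.le_nearestDist_iff r ω).1 h i _)), tsum_zero]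
    rw [indicator_of_mem (by exact h)]
    simp [h0]
  · rw [indicator_of_notMem (by exact h)]
    rw [le_nearestDist_iff] at h
    push Not at h
    obtain ⟨i, k, hik⟩ := h
    have htop : N.roadSum (voidTerm r) i ω = ∞ :=
      ENNReal.tsum_eq_top_of_eq_top ⟨k, by rw [hterm, if_pos hik]⟩
    cases i with
    | none => rw [htop, expNeg_top, mul_zero]
    | some n => rw [ENNReal.tsum_eq_top_of_eq_top ⟨n, htop⟩, expNeg_top, zero_mul]

end RoadNetwork

namespace IsPoissonRoadNetwork

variable {Ω : Type*} [mΩ : MeasurableSpace Ω] {N : RoadNetwork Ω} {P : Measure Ω} {lam mu : ℝ}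

lemma measurable_norm_loc (hN : IsPoissonRoadNetwork N P lam mu) (i : Option ℕ) (k : ℕ) :
    Measurable fun ω => ‖N.loc i k ω‖ := by
  simp_rw [RoadNetwork.norm_loc]
  have h1 := hN.measurable_line i
  have h2 := (hN.vehicles i).measurable k
  fun_prop

lemma measurable_nearestDist (hN : IsPoissonRoadNetwork N P lam mu) :
    Measurable N.nearestDist :=
  Measurable.iInf fun p => hN.measurable_norm_loc p.1 p.2

variable [IsProbabilityMeasure P]

/-- Probability that there is no vehicle within distance `r`. -/
lemma measure_le_nearestDist (hN : IsPoissonRoadNetwork N P lam mu) (hlam : 0 < lam)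
    (hmu : 0 < mu) {r : ℝ} (hr : 0 < r) :
    P {ω | r ≤ N.nearestDist ω} = ENNReal.ofReal (survival lam mu r) := by
  have hm := measurable_voidTerm r
  have hms : MeasurableSet {ω | r ≤ N.nearestDist ω} :=
    measurableSet_le measurable_const hN.measurable_nearestDist
  rw [← lintegral_indicator_one hms]
  simp_rw [← RoadNetwork.expNeg_voidTerm_eq_indicator]
  rw [hN.lintegral_expNeg_mul_expNeg hm hm, hN.lintegral_expNeg_typical_road hm,
    hN.lintegral_expNeg_other_roads hm]
  simp_rw [roadLaplace_voidTerm hmu hr]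
  set F : ℝ → ℝ := fun y => 1 - Real.exp (-2 * mu * Real.sqrt (r ^ 2 - y ^ 2)) with hF
  have hFc : Continuous F := by fun_prop
  have hF0 (y : ℝ) : 0 ≤ F y := by
    rw [hF, sub_nonneg, Real.exp_le_one_iff]
    nlinarith [Real.sqrt_nonneg (r ^ 2 - y ^ 2)]
  have h1 (l : ℝ × ℝ) : 1 - ENNReal.ofReal (Real.exp (-2 * mu * Real.sqrt (r ^ 2 - l.2 ^ 2)))
      = ENNReal.ofReal (F |l.2|) := by
    rw [← ENNReal.ofReal_one, ← ENNReal.ofReal_sub _ (Real.exp_pos _).le, hF]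
    simp only [sq_abs]
  have h2 : ∫⁻ y in Ioi r, ENNReal.ofReal (F y) = 0 := by
    rw [setLIntegral_congr_fun measurableSet_Ioi (g := fun _ => 0) fun y hy => ?_]
    · simp
    · have : r ^ 2 - y ^ 2 ≤ 0 := by
        have := mem_Ioi.1 hy
        nlinarith
      simp [hF, Real.sqrt_eq_zero_of_nonpos this]
  have h3 : ∫⁻ y in Ioc 0 r, ENNReal.ofReal (F y)
      = ENNReal.ofReal (r * chordMean (2 * mu * r)) := by
    rw [← integral_one_sub_exp_sqrt hr.le, intervalIntegral.integral_of_le hr.le,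
      ofReal_integral_eq_lintegral_ofReal (hFc.integrableOn_Ioc) (.of_forall hF0)]
  have hc := chordMean_nonneg (c := 2 * mu * r) (by positivity)
  have hpi := Real.pi_pos
  rw [lintegral_congr h1,
    lintegral_road_intensity (F := fun y => ENNReal.ofReal (F y)) hFc.measurable.ennreal_ofReal,
    ← Ioc_union_Ioi_eq_Ioi hr.le, lintegral_union measurableSet_Ioi Ioc_disjoint_Ioi_same, h2, h3,
    add_zero, ← ENNReal.ofReal_mul (by positivity), expNeg_ofReal (by positivity),
    ← ENNReal.ofReal_mul (Real.exp_pos _).le, ← Real.exp_add, survival]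
  congr 2
  simp only [zero_pow two_ne_zero, sub_zero, Real.sqrt_sq hr.le]
  ring

theorem map_nearestDist (hN : IsPoissonRoadNetwork N P lam mu) (hlam : 0 < lam) (hmu : 0 < mu) :
    P.map N.nearestDist = (volume.restrict (Ioi (0 : ℝ))).withDensity
      (fun r => ENNReal.ofReal (pdfRv lam mu r)) := by
  have hm := hN.measurable_nearestDist
  have : IsProbabilityMeasure (P.map N.nearestDist) :=
    Measure.isProbabilityMeasure_map hm.aemeasurable
  refine Measure.ext_of_Ici _ _ fun a => ?_
  rw [Measure.map_apply hm measurableSet_Ici, withDensity_apply _ measurableSet_Ici,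
    Measure.restrict_restrict measurableSet_Ici]
  rcases le_or_gt a 0 with ha | ha
  · have h1 : N.nearestDist ⁻¹' Ici a = univ :=
      eq_univ_of_forall fun ω => ha.trans (Real.iInf_nonneg fun _ => norm_nonneg _)
    rw [h1, measure_univ, inter_eq_right.2 (Ioi_subset_Ici ha),
      lintegral_pdfRv hlam hmu le_rfl]
    simp [survival]
  · rw [inter_eq_left.2 (Ici_subset_Ioi.2 ha), setLIntegral_congr Ioi_ae_eq_Ici.symm,
      lintegral_pdfRv hlam hmu ha.le]
    exact hN.measure_le_nearestDist hlam hmu ha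

end IsPoissonRoadNetwork

/-! ### Success probability -/

/-- Tail of the exponential distribution, in the form of the event that the signal-to-interference
ratio exceeds the threshold; it includes the degenerate denominators `0` and `∞`. -/
lemma expMeasure_lt_div {c z : ℝ} (hc : 0 < c) (hz : 0 < z) (v : ℝ≥0∞) :
    expMeasure 1 {h | ENNReal.ofReal z < ENNReal.ofReal (c * h) / v}
      = expNeg (ENNReal.ofReal (z / c) * v) := by
  have hz' : ENNReal.ofReal z ≠ 0 := by simpa using hz
  rcases eq_or_ne v ∞ with rfl | hv
  · simp [ENNReal.mul_top, hz, hc]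
  lift v to NNReal using hv
  have h1 : {h | ENNReal.ofReal z < ENNReal.ofReal (c * h) / (v : ℝ≥0∞)}
      = Ioi (z / c * v) := by
    ext h
    rw [mem_ofPred_eq, ENNReal.lt_div_iff_mul_lt (Or.inr ENNReal.ofReal_ne_top) (Or.inr hz'),
      ← ENNReal.ofReal_coe_nnreal, ← ENNReal.ofReal_mul hz.le,
      ENNReal.ofReal_lt_ofReal_iff_of_nonneg (by positivity), mem_Ioi, div_mul_eq_mul_div,
      div_lt_iff₀' hc]
  rw [h1, expMeasure_Ioi (by positivity), ← ENNReal.ofReal_coe_nnreal,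
    ← ENNReal.ofReal_mul (by positivity), expNeg_ofReal (by positivity)]

lemma measurable_laplace {Ω : Type*} [MeasurableSpace Ω] {P : Measure Ω} [SFinite P]
    {X : ℝ → Ω → ℝ≥0∞} (hX : Measurable fun p : ℝ × Ω => X p.1 p.2)
    {s : ℝ → ℝ} (hs : Measurable s) : Measurable fun r => laplace P (X r) (s r) := by
  have : Measurable fun p : ℝ × Ω => expNeg (ENNReal.ofReal (s p.1) * X p.1 p.2) :=
    measurable_expNeg.comp ((hs.comp measurable_fst).ennreal_ofReal.mul hX)
  exact this.lintegral_prod_right'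

namespace IsPoissonRoadNetwork

variable {Ω : Type*} [mΩ : MeasurableSpace Ω] {N : RoadNetwork Ω} {P : Measure Ω} {lam mu : ℝ}

/-- Joint measurability in the radius and the sample point. -/
lemma measurable_roadInterference (hN : IsPoissonRoadNetwork N P lam mu) (Pv α : ℝ)
    (i : Option ℕ) : Measurable fun p : ℝ × Ω => N.roadInterference Pv α p.1 i p.2 := by
  refine Measurable.tsum fun k => ?_
  have h1 : Measurable fun p : ℝ × Ω => ‖N.loc i k p.2‖ :=
    (hN.measurable_norm_loc i k).comp measurable_snd
  have h2 : Measurable fun p : ℝ × Ω => N.gain i k p.2 :=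
    (hN.gain_measurable i k).comp measurable_snd
  exact Measurable.ite (measurableSet_lt measurable_fst h1) (by fun_prop) measurable_const

variable [IsProbabilityMeasure P]

/-- The gain of the link is exponential and independent of the interference, so the success
probability is a Laplace transform of interference plus noise; the interferences of the typical
road and of the other roads are independent. -/
theorem condSuccessProb_eq (hN : IsPoissonRoadNetwork N P lam mu) {Pv α σ z r : ℝ} (hPv : 0 < Pv)
    (hz : 0 < z) (hr : 0 < r) :
    N.condSuccessProb P Pv α σ z r
      = ENNReal.ofReal (Real.exp (-(z * σ ^ 2 / (Pv * r ^ (-α)))))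
          * laplace P (N.Iv Pv α r) (z / (Pv * r ^ (-α)))
          * laplace P (N.Ir Pv α r) (z / (Pv * r ^ (-α))) := by
  set c := Pv * r ^ (-α) with hc
  have hc0 : 0 < c := by positivity
  set s := z / c with hs
  have hs0 : 0 < s := by positivity
  let J : Ω → ℝ≥0∞ := fun ω => N.Iv Pv α r ω + N.Ir Pv α r ω + ENNReal.ofReal (σ ^ 2)
  let T : Set Source := {Source.link}
  have hRI (i : Option ℕ) : Measurable[N.sigmaOf Tᶜ] (N.roadInterference Pv α r i) := by
    have h1 : N.roadInterference Pv α r i = N.roadSum (interferenceTerm Pv α 1 r) i := by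
      ext ω
      rw [← RoadNetwork.mul_roadInterference, ENNReal.ofReal_one, one_mul]
    rw [h1]
    refine RoadNetwork.measurable_roadSum_sigmaOf (measurable_interferenceTerm Pv α 1 r)
      (fun _ => ?_) ?_ (fun k => ?_) <;> · intro h; cases h
  have hJ : Measurable[N.sigmaOf Tᶜ] J :=
    ((measurable_tsum_ennreal fun n => hRI (some n)).add (hRI none)).add measurable_const
  have hind : IndepFun J N.linkGain P :=
    indep_of_indep_of_le_left (indep_of_indep_of_le_right
      (hN.indep_sigmaOf (disjoint_compl_left (a := T)))
      (RoadNetwork.sigma_le_sigmaOf (N := N) (s := Source.link) (mem_singleton _))) hJ.comap_le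
  have hJm := hJ.mono (hN.sigmaOf_le _) le_rfl
  let A : Set (ℝ≥0∞ × ℝ) := {p | ENNReal.ofReal z < ENNReal.ofReal (c * p.2) / p.1}
  have hA : MeasurableSet A := measurableSet_lt measurable_const (by fun_prop)
  have h1 : N.condSuccessProb P Pv α σ z r
      = ∫⁻ ω, A.indicator 1 (J ω, N.linkGain ω) ∂P := by
    have hpre : {ω | ENNReal.ofReal z < N.sinr Pv α σ r ω}
        = (fun ω => (J ω, N.linkGain ω)) ⁻¹' A := rfl
    rw [RoadNetwork.condSuccessProb, hpre,
      ← lintegral_indicator_one ((hJm.prodMk hN.link_measurable) hA)]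
    rfl
  have h2 (v : ℝ≥0∞) : ∫⁻ ω, A.indicator 1 (v, N.linkGain ω) ∂P
      = expNeg (ENNReal.ofReal s * v) := by
    have hpre : {h | ENNReal.ofReal z < ENNReal.ofReal (c * h) / v} = Prod.mk v ⁻¹' A := rfl
    rw [← expMeasure_lt_div hc0 hz, ← hN.link_law, hpre,
      Measure.map_apply hN.link_measurable (measurable_prodMk_left hA),
      ← lintegral_indicator_one (hN.link_measurable (measurable_prodMk_left hA))]
    rfl
  rw [h1, lintegral_indepFun_eq hJm hN.link_measurable hind
    (f := fun v h => A.indicator 1 (v, h)) (measurable_one.indicator hA)]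
  simp_rw [h2]
  have h3 (ω : Ω) : expNeg (ENNReal.ofReal s * J ω)
      = ENNReal.ofReal (Real.exp (-(z * σ ^ 2 / c)))
        * (expNeg (∑' n, N.roadSum (interferenceTerm Pv α s r) (some n) ω)
          * expNeg (N.roadSum (interferenceTerm Pv α s r) none ω)) := by
    simp only [J]
    rw [mul_add, mul_add, expNeg_add, expNeg_add, ← ENNReal.ofReal_mul hs0.le,
      expNeg_ofReal (by positivity), mul_comm, RoadNetwork.Iv, ← ENNReal.tsum_mul_left,
      RoadNetwork.Ir]
    simp_rw [RoadNetwork.mul_roadInterference]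
    rw [hs, div_mul_eq_mul_div]
  have hm := measurable_interferenceTerm Pv α s r
  rw [lintegral_congr h3, lintegral_const_mul, hN.lintegral_expNeg_mul_expNeg hm hm,
    ← laplace_Iv_eq, ← laplace_Ir_eq, mul_assoc]
  exact (measurable_expNeg.comp (Measurable.tsum fun n => hN.measurable_roadSum hm _)).mul
    (measurable_expNeg.comp (hN.measurable_roadSum hm _))

theorem successProb_eq (hN : IsPoissonRoadNetwork N P lam mu) (hlam : 0 < lam) (hmu : 0 < mu)
    {Pv α σ z : ℝ} (hPv : 0 < Pv) (hz : 0 < z) :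
    N.successProb P Pv α σ z
      = ∫⁻ r in Ioi (0 : ℝ),
          ENNReal.ofReal (Real.exp (-(z * σ ^ 2 / (Pv * r ^ (-α)))))
            * laplace P (N.Iv Pv α r) (z / (Pv * r ^ (-α)))
            * laplace P (N.Ir Pv α r) (z / (Pv * r ^ (-α)))
            * ENNReal.ofReal (pdfRv lam mu r) := by
  have hm := hN.measurable_nearestDist
  have hmap := hN.map_nearestDist hlam hmu
  set Ψ : ℝ → ℝ≥0∞ := fun r => ENNReal.ofReal (Real.exp (-(z * σ ^ 2 / (Pv * r ^ (-α)))))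
    * laplace P (N.Iv Pv α r) (z / (Pv * r ^ (-α)))
    * laplace P (N.Ir Pv α r) (z / (Pv * r ^ (-α))) with hΨ
  have hsm : Measurable fun r : ℝ => z / (Pv * r ^ (-α)) := by fun_prop
  have hΨm : Measurable Ψ := by
    refine ((by fun_prop : Measurable fun r : ℝ =>
      ENNReal.ofReal (Real.exp (-(z * σ ^ 2 / (Pv * r ^ (-α)))))).mul
      (measurable_laplace ?_ hsm)).mul (measurable_laplace ?_ hsm)
    · exact Measurable.tsum fun n => hN.measurable_roadInterference Pv α (some n)
    · exact hN.measurable_roadInterference Pv α none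
  have hpos : ∀ᵐ ω ∂P, 0 < N.nearestDist ω := by
    have h1 : P.map N.nearestDist (Iic 0) = 0 := by
      rw [hmap, withDensity_apply _ measurableSet_Iic, Measure.restrict_restrict measurableSet_Iic,
        Iic_inter_Ioi, Ioc_self, Measure.restrict_empty, lintegral_zero_measure]
    rw [Measure.map_apply hm measurableSet_Iic] at h1
    rw [ae_iff]
    simpa [preimage, not_lt] using h1
  calc N.successProb P Pv α σ z
      = ∫⁻ ω, Ψ (N.nearestDist ω) ∂P :=
        lintegral_congr_ae (hpos.mono fun ω hω => hN.condSuccessProb_eq hPv hz hω)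
    _ = ∫⁻ r, Ψ r ∂(P.map N.nearestDist) := (lintegral_map hΨm hm).symm
    _ = ∫⁻ r in Ioi (0 : ℝ), Ψ r * ENNReal.ofReal (pdfRv lam mu r) := by
        rw [hmap, lintegral_withDensity_eq_lintegral_mul₀
          (integrableOn_pdfRv hlam hmu le_rfl).aestronglyMeasurable.aemeasurable.ennreal_ofReal
          hΨm.aemeasurable]
        exact lintegral_congr fun r => mul_comm _ _

end IsPoissonRoadNetwork

end V2V

end

theorem mainTheorem11 {Ω : Type*} [MeasurableSpace Ω] (P : Measure Ω) [IsProbabilityMeasure P]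
    (lam mu Pv α σ z : ℝ) (hlam : 0 < lam) (hmu : 0 < mu) (hPv : 0 < Pv) (hα : 1 < α)
    (hz : 0 < z) (N : V2V.RoadNetwork Ω) (hN : V2V.IsPoissonRoadNetwork N P lam mu) :
    P.map N.nearestDist
        = (volume.restrict (Ioi (0 : ℝ))).withDensity
            (fun r => ENNReal.ofReal (V2V.pdfRv lam mu r))
      ∧ (∀ r s : ℝ, 0 < r → 0 < s →
          V2V.laplace P (N.Iv Pv α r) s = V2V.lapIv lam mu Pv α s r)
      ∧ (∀ r : ℝ, 0 < r →
          V2V.laplace P (N.Ir Pv α r) (z / (Pv * r ^ (-α))) = V2V.lapIr mu α z r)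
      ∧ N.successProb P Pv α σ z
          = ∫⁻ r in Ioi (0 : ℝ),
              ENNReal.ofReal (Real.exp (-(z * σ ^ 2 / (Pv * r ^ (-α)))))
                * V2V.laplace P (N.Iv Pv α r) (z / (Pv * r ^ (-α)))
                * V2V.laplace P (N.Ir Pv α r) (z / (Pv * r ^ (-α)))
                * ENNReal.ofReal (V2V.pdfRv lam mu r) :=
  ⟨hN.map_nearestDist hlam hmu, fun _ _ hr hs => hN.laplace_Iv hPv hr hs,
    fun r hr => (hN.laplace_Ir_eq_lapRoad hPv hr (by positivity)).trans
      (V2V.lapRoad_typical_road hmu hPv hα hz hr),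
    hN.successProb_eq hlam hmu hPv hz⟩
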